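/- Theorem 3.6 (Goodwillie). Let $k$ be a field of characteristic zero, let $C$ be a unital associative $k$-algebra, let $M$ be a two-sided ideal of $C$, and let $A = C/M$. If $M$ is nilpotent (that is, $M^r = 0$ for some $r$), then for every $n \in \mathbb{Z}$ the map $$\mathrm{HP}_n(C) \to \mathrm{HP}_n(A)$$ induced by the canonical projection $C \to A$ is an isomorphism of $k$-modules. Here $\mathrm{HP}_n(C)$ denotes periodic cyclic homology over $k$: writing $\overline{C} = C/k\cdot 1$, it is the $n$-th homology of the complex whose degree $n$ part is $\prod_{p \in \mathbb{Z},\, n-2p \ge 0} C \otimes \overline{C}^{\otimes (n-2p)}$, with differential $b + B$, where $$b(x_0 \otimes \cdots \otimes x_m) = \sum_{j=0}^{m-1} (-1)^j x_0 \otimes \cdots \otimes x_j x_{j+1} \otimes \cdots \otimes x_m + (-1)^m x_m x_0 \otimes x_1 \otimes \cdots \otimes x_{m-1}$$ for $m \ge 1$ ($b = 0$ for $m = 0$), and $$B(x_0 \otimes \cdots \otimes x_m) = \sum_{i=0}^{m} (-1)^{im}\, 1 \otimes x_i \otimes \cdots \otimes x_m \otimes x_0 \otimes \cdots \otimes x_{i-1}.$$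 -/

import Mathlib

open scoped TensorProduct

namespace CyclicHomology

universe u v w

/-! ### Mixed complexes and their periodic homology -/

/-- A mixed complex `(X, b, B)` of `k`-modules, graded by `ℕ`. -/
structure MixedComplex (k : Type u) [CommRing k] where
  X : ℕ → Type w
  [addCommGroup : ∀ n, AddCommGroup (X n)]
  [module : ∀ n, Module k (X n)]
  b : ∀ n, X (n + 1) →ₗ[k] X n
  B : ∀ n, X n →ₗ[k] X (n + 1)
  b_b : ∀ n x, b n (b (n + 1) x) = 0
  B_B : ∀ n x, B (n + 1) (B n x) = 0
  /-- `B b + b B = 0` in positive degrees. -/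
  B_b_add_b_B : ∀ n x, B n (b n x) + b (n + 1) (B (n + 1) x) = 0
  /-- `B b + b B = 0` in degree `0`, where `b = 0`. -/
  b_B_zero : ∀ x, b 0 (B 0 x) = 0

attribute [instance] MixedComplex.addCommGroup MixedComplex.module

namespace MixedComplex

variable {k : Type u} [CommRing k]

/-- A morphism of mixed complexes. -/
structure Hom (X Y : MixedComplex.{u, w} k) where
  f : ∀ n, X.X n →ₗ[k] Y.X n
  comm_b : ∀ n x, f n (X.b n x) = Y.b n (f (n + 1) x)
  comm_B : ∀ n x, f (n + 1) (X.B n x) = Y.B n (f n x)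

/-- Degree `n` of the total complex (formed with products) of the periodic double complex `BP(X)`.
The double complex has `X_{q - p}` in position `(p, q)` for all integers `p ≤ q`, so the total
degree `n` part is the product of the `X_{n - 2p}` over all integers `p` with `n - 2p ≥ 0`.
We index the factors by `m = n - 2p`, which runs over the `m ≥ 0` of the same parity as `n`. -/
abbrev PerTot (X : MixedComplex.{u, w} k) (n : ℤ) : Type w :=
  ∀ m : {m : ℕ // Even (n - (m : ℤ))}, X.X m.1

lemma even_b {i j : ℤ} (h : j + 1 = i) {m : ℕ} (hm : Even (j - (m : ℤ))) :
    Even (i - ((m + 1 : ℕ) : ℤ)) := by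
  subst h; push_cast; rwa [add_sub_add_right_eq_sub]

lemma even_B {i j : ℤ} (h : j + 1 = i) {m : ℕ} (hm : Even (j - ((m + 1 : ℕ) : ℤ))) :
    Even (i - (m : ℤ)) := by
  subst h
  obtain ⟨r, hr⟩ := hm
  exact ⟨r + 1, by push_cast at hr; linarith⟩

/-- The vertical differential `b` of `BP(X)` on the total complex:
the component in `X_m` of `b x` is `b (x_{m+1})`. -/
def perb (X : MixedComplex.{u, w} k) {i j : ℤ} (h : j + 1 = i) : X.PerTot i →ₗ[k] X.PerTot j where
  toFun x := fun m => X.b m.1 (x ⟨m.1 + 1, even_b h m.2⟩)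
  map_add' x y := by funext m; simp
  map_smul' r x := by funext m; simp

/-- The horizontal differential `B` of `BP(X)` on the total complex:
the component in `X_0` of `B x` is `0`, and the component in `X_{m+1}` is `B (x_m)`. -/
def perB (X : MixedComplex.{u, w} k) {i j : ℤ} (h : j + 1 = i) : X.PerTot i →ₗ[k] X.PerTot j where
  toFun x := fun
    | ⟨0, _⟩ => 0
    | ⟨m + 1, hm⟩ => X.B m (x ⟨m, even_B h hm⟩)
  map_add' x y := by
    funext m
    obtain ⟨_ | m, hm⟩ := m <;> simp
  map_smul' r x := by
    funext m
    obtain ⟨_ | m, hm⟩ := m <;> simp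

lemma per_d_d (X : MixedComplex.{u, w} k) {i j l : ℤ} (h : j + 1 = i) (h' : l + 1 = j)
    (x : X.PerTot i) :
    (X.perb h' + X.perB h') ((X.perb h + X.perB h) x) = 0 := by
  funext m
  obtain ⟨m, hm⟩ := m
  match m, hm with
  | 0, hm => simp [perb, perB, X.b_b, X.b_B_zero]
  | 1, hm =>
    have := X.B_b_add_b_B 0 (x ⟨1, even_b h (even_B h' hm)⟩)
    simpa [perb, perB, X.b_b, add_comm] using this
  | m + 2, hm =>
    have := X.B_b_add_b_B (m + 1) (x ⟨m + 2, even_b h (even_B h' hm)⟩)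
    simpa [perb, perB, X.b_b, X.B_B, add_comm (X.b _ _)] using this

/-- The total complex of the periodic double complex `BP(X)`, with differential `b + B`. -/
noncomputable def periodicComplex (X : MixedComplex.{u, w} k) :
    ChainComplex (ModuleCat.{w} k) ℤ where
  X n := ModuleCat.of k (X.PerTot n)
  d i j := if h : j + 1 = i then ModuleCat.ofHom (X.perb h + X.perB h) else 0
  shape i j h := dif_neg h
  d_comp_d' i j l h h' := by
    have h₁ : j + 1 = i := h
    have h₂ : l + 1 = j := h'
    rw [dif_pos h₁, dif_pos h₂]
    exact ModuleCat.hom_ext (LinearMap.ext (X.per_d_d h₁ h₂))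

/-- The map of total complexes induced by a morphism of mixed complexes. -/
noncomputable def periodicMap {X Y : MixedComplex.{u, w} k} (φ : Hom X Y) :
    X.periodicComplex ⟶ Y.periodicComplex where
  f n := ModuleCat.ofHom (LinearMap.pi fun m => φ.f m.1 ∘ₗ LinearMap.proj m)
  comm' i j h := by
    have h₁ : j + 1 = i := h
    simp only [periodicComplex, dif_pos h₁]
    refine ModuleCat.hom_ext (LinearMap.ext fun x => funext fun m => ?_)
    obtain ⟨_ | m, hm⟩ := m
    · simp [perb, perB, φ.comm_b]
    · simp [perb, perB, φ.comm_b, φ.comm_B]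

end MixedComplex

/-! ### The normalized mixed complex of an algebra -/

section Algebra

variable (k : Type u) [CommRing k] (C : Type v) [Ring C] [Algebra k C]

/-- `C^{⊗ (n+1)}`, the tensor power over `k` with factors numbered `0, …, n`. -/
abbrev Tens (n : ℕ) : Type (max u v) := ⨂[k] _ : Fin (n + 1), C

variable {C}

/-- The `j`-th face of `(x_0, …, x_{n+1})`: for `j ≤ n` it is
`(x_0, …, x_j x_{j+1}, …, x_{n+1})`, and for `j = n + 1` it is `(x_{n+1} x_0, x_1, …, x_n)`. -/
def faceFun {n : ℕ} (j : Fin (n + 2)) (x : Fin (n + 2) → C) : Fin (n + 1) → C :=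
  if j = Fin.last (n + 1) then Function.update (Fin.init x) 0 (x (Fin.last (n + 1)) * x 0)
  else j.contractNth (· * ·) x

lemma faceFun_apply {n : ℕ} (j : Fin (n + 2)) (x : Fin (n + 2) → C) (i : Fin (n + 1)) :
    faceFun j x i =
      if (i : ℕ) < j then
        if (i : ℕ) = 0 ∧ (j : ℕ) = n + 1 then x (Fin.last (n + 1)) * x ⟨0, by omega⟩ else x i.castSucc
      else if (i : ℕ) = j then x i.castSucc * x i.succ else x i.succ := by
  have := i.2
  by_cases hj : j = Fin.last (n + 1)
  · subst hj
    by_cases hi : i = 0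
    · subst hi; simp [faceFun]
    · have hi' : (i : ℕ) ≠ 0 := fun h => hi (Fin.ext h)
      have h₂ : (i : ℕ) ≤ n := by omega
      simp [faceFun, hi, hi', h₂, Fin.init]
  · have hj' : (j : ℕ) ≠ n + 1 := fun h => hj (Fin.ext h)
    simp [faceFun, hj, hj', Fin.contractNth]

lemma faceFun_faceFun {n : ℕ} (i : Fin (n + 2)) (j : Fin (n + 3)) (h : (i : ℕ) < j)
    (x : Fin (n + 3) → C) :
    faceFun i (faceFun j x) =
      faceFun (⟨(j : ℕ) - 1, by omega⟩ : Fin (n + 2)) (faceFun i.castSucc x) := by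
  ext m
  obtain ⟨m, hm⟩ := m
  obtain ⟨i, hi⟩ := i
  obtain ⟨j, hj⟩ := j
  simp only [faceFun_apply, Fin.castSucc_mk, Fin.succ_mk, Fin.last] at h ⊢
  grind

lemma faceFun_update {n : ℕ} (j : Fin (n + 2)) (m : Fin (n + 2)) (x : Fin (n + 2) → C) :
    ∃ (m' : Fin (n + 1)) (g : C →ₗ[k] C),
      ∀ c, faceFun j (Function.update x m c) = Function.update (faceFun j x) m' (g c) := by
  obtain ⟨j, hj⟩ := j
  obtain ⟨m, hm⟩ := m
  have key : ∀ (m' : Fin (n + 1)) (g : C →ₗ[k] C),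
      (∀ c (i : ℕ) (hi : i < n + 1),
        faceFun ⟨j, hj⟩ (Function.update x ⟨m, hm⟩ c) ⟨i, hi⟩ =
          if i = m' then g c else faceFun ⟨j, hj⟩ x ⟨i, hi⟩) →
      ∃ (m' : Fin (n + 1)) (g : C →ₗ[k] C), ∀ c,
        faceFun ⟨j, hj⟩ (Function.update x ⟨m, hm⟩ c) =
          Function.update (faceFun ⟨j, hj⟩ x) m' (g c) := by
    intro m' g h
    refine ⟨m', g, fun c => funext fun i => ?_⟩
    rw [Function.update_apply]
    simpa [Fin.ext_iff] using h c i i.2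
  simp only [faceFun_apply, Fin.castSucc_mk, Fin.succ_mk, Fin.last, Function.update_apply,
    Fin.ext_iff] at key
  by_cases hj' : j = n + 1
  · by_cases hm₁ : m = n + 1
    · refine key 0 (LinearMap.mulRight k (x 0)) fun c i hi => ?_
      simp only [LinearMap.mulRight_apply, Fin.val_zero]
      grind
    by_cases hm₂ : m = 0
    · refine key 0 (LinearMap.mulLeft k (x (Fin.last (n + 1)))) fun c i hi => ?_
      simp only [LinearMap.mulLeft_apply, Fin.last, Fin.val_zero]
      grind
    · refine key ⟨m, by omega⟩ LinearMap.id fun c i hi => ?_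
      simp only [LinearMap.id_apply]
      grind
  by_cases hm₁ : m = j
  · refine key ⟨j, by omega⟩ (LinearMap.mulRight k (x ⟨j + 1, by omega⟩)) fun c i hi => ?_
    simp only [LinearMap.mulRight_apply]
    grind
  by_cases hm₂ : m = j + 1
  · refine key ⟨j, by omega⟩ (LinearMap.mulLeft k (x ⟨j, by omega⟩)) fun c i hi => ?_
    simp only [LinearMap.mulLeft_apply]
    grind
  by_cases hm₃ : m < j
  · refine key ⟨m, by omega⟩ LinearMap.id fun c i hi => ?_
    simp only [LinearMap.id_apply]
    grind
  · refine key ⟨m - 1, by omega⟩ LinearMap.id fun c i hi => ?_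
    simp only [LinearMap.id_apply]
    grind

variable (C)

/-- The `j`-th face map `C^{⊗ (n+2)} → C^{⊗ (n+1)}`. -/
noncomputable def face {n : ℕ} (j : Fin (n + 2)) : Tens k C (n + 1) →ₗ[k] Tens k C n :=
  PiTensorProduct.lift
    { toFun := fun x => PiTensorProduct.tprod k (faceFun j x)
      map_update_add' := fun {inst} x m a a' => by
        obtain rfl : inst = instDecidableEqFin _ := Subsingleton.elim _ _
        obtain ⟨m', g, hg⟩ := faceFun_update k j m x
        rw [hg, hg, hg, map_add, MultilinearMap.map_update_add]
      map_update_smul' := fun {inst} x m r a => by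
        obtain rfl : inst = instDecidableEqFin _ := Subsingleton.elim _ _
        obtain ⟨m', g, hg⟩ := faceFun_update k j m x
        rw [hg, hg, map_smul, MultilinearMap.map_update_smul] }

/-- The signed cyclic permutation `x_0 ⊗ ⋯ ⊗ x_n ↦ (-1)^n x_n ⊗ x_0 ⊗ ⋯ ⊗ x_{n-1}`. -/
noncomputable def cyc (n : ℕ) : Tens k C n →ₗ[k] Tens k C n :=
  (-1 : k) ^ n • (PiTensorProduct.reindex k (fun _ => C) (finRotate (n + 1))).toLinearMap

/-- `x_0 ⊗ ⋯ ⊗ x_n ↦ 1 ⊗ x_0 ⊗ ⋯ ⊗ x_n`. -/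
noncomputable def consOne (n : ℕ) : Tens k C n →ₗ[k] Tens k C (n + 1) :=
  PiTensorProduct.lift ((PiTensorProduct.tprod k (s := fun _ : Fin (n + 2) => C)).curryLeft 1)

/-- The Hochschild boundary
`b (x_0 ⊗ ⋯ ⊗ x_{n+1}) = ∑_{j=0}^{n} (-1)^j x_0 ⊗ ⋯ ⊗ x_j x_{j+1} ⊗ ⋯ ⊗ x_{n+1}
+ (-1)^{n+1} x_{n+1} x_0 ⊗ x_1 ⊗ ⋯ ⊗ x_n`. -/
noncomputable def hochb (n : ℕ) : Tens k C (n + 1) →ₗ[k] Tens k C n :=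
  ∑ j : Fin (n + 2), (-1 : k) ^ (j : ℕ) • face k C j

/-- The Connes operator
`B (x_0 ⊗ ⋯ ⊗ x_n) = ∑_{i=0}^{n} (-1)^{i n} 1 ⊗ x_i ⊗ ⋯ ⊗ x_n ⊗ x_0 ⊗ ⋯ ⊗ x_{i-1}`
(the term for `i` comes from the power `n + 1 - i` of `cyc`). -/
noncomputable def connesB (n : ℕ) : Tens k C n →ₗ[k] Tens k C (n + 1) :=
  consOne k C n ∘ₗ ∑ i ∈ Finset.range (n + 1), (cyc k C n) ^ i

/-- The span of the tensors `x_0 ⊗ ⋯ ⊗ x_n` in which some `x_i` with `i > 0` is equal to `1`. -/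
def degenerate (n : ℕ) : Submodule k (Tens k C n) :=
  Submodule.span k {z | ∃ x : Fin (n + 1) → C, (∃ i, i ≠ 0 ∧ x i = 1) ∧
    z = PiTensorProduct.tprod k x}


/-! #### Effect on pure tensors -/

/-- The cyclic permutation `(x_0, …, x_n) ↦ (x_n, x_0, …, x_{n-1})`. -/
def rotFun {C : Type v} {n : ℕ} (x : Fin (n + 1) → C) : Fin (n + 1) → C :=
  fun i => x ((finRotate (n + 1)).symm i)

lemma rotFun_apply {C : Type v} {n : ℕ} (x : Fin (n + 1) → C) (i : Fin (n + 1)) :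
    rotFun x i = if (i : ℕ) = 0 then x (Fin.last n) else x ⟨(i : ℕ) - 1, by omega⟩ := by
  unfold rotFun
  have h : ∀ j, finRotate (n + 1) j = i → x ((finRotate (n + 1)).symm i) = x j := by
    rintro j rfl; simp
  split_ifs with h0
  · apply h
    rw [finRotate_last]
    exact Fin.ext h0.symm
  · apply h
    rw [finRotate_of_lt (by omega)]
    ext; simp; omega

lemma face_tprod {n : ℕ} (j : Fin (n + 2)) (x : Fin (n + 2) → C) :
    face k C j (PiTensorProduct.tprod k x) = PiTensorProduct.tprod k (faceFun j x) := by
  simp [face]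

lemma cyc_tprod {n : ℕ} (x : Fin (n + 1) → C) :
    cyc k C n (PiTensorProduct.tprod k x) = (-1 : k) ^ n • PiTensorProduct.tprod k (rotFun x) := by
  simp only [cyc, LinearMap.smul_apply, LinearEquiv.coe_coe]
  rw [PiTensorProduct.reindex_tprod]
  rfl

lemma consOne_tprod {n : ℕ} (x : Fin (n + 1) → C) :
    consOne k C n (PiTensorProduct.tprod k x) =
      PiTensorProduct.tprod k (Fin.cons 1 x : Fin (n + 2) → C) := by
  simp [consOne]

/-! #### The mixed complex identities -/

variable {k C} in
lemma tens_ext {n : ℕ} {E : Type*} [AddCommGroup E] [Module k E] {f g : Tens k C n →ₗ[k] E}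
    (h : ∀ x : Fin (n + 1) → C,
      f (PiTensorProduct.tprod k x) = g (PiTensorProduct.tprod k x)) : f = g :=
  PiTensorProduct.ext (MultilinearMap.ext h)

lemma hochb_hochb (n : ℕ) : hochb k C n ∘ₗ hochb k C (n + 1) = 0 := by
  refine tens_ext fun x => ?_
  simp only [hochb, LinearMap.comp_apply, LinearMap.sum_apply, LinearMap.smul_apply, map_sum,
    map_smul, face_tprod, LinearMap.zero_apply, Finset.smul_sum, smul_smul, ← pow_add]
  rw [← Finset.sum_product']
  refine Finset.sum_involution
    (fun p _ => if h : (p.2 : ℕ) < p.1 then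
        ((⟨p.2, by omega⟩ : Fin (n + 3)), (⟨(p.1 : ℕ) - 1, by omega⟩ : Fin (n + 2)))
      else (⟨(p.2 : ℕ) + 1, by omega⟩, ⟨p.1, by omega⟩)) ?_ ?_ ?_ ?_
  · rintro ⟨j, i⟩ -
    dsimp only
    split_ifs with h
    · rw [faceFun_faceFun i j h]
      have : (j : ℕ) + i = (i + (j - 1)) + 1 := by omega
      simp only [this, pow_succ, mul_neg, mul_one, neg_smul]
      exact neg_add_cancel _
    · have h' : (j : ℕ) < i + 1 := by omega
      have := faceFun_faceFun ⟨j, by omega⟩ (⟨(i : ℕ) + 1, by omega⟩ : Fin (n + 3)) h' x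
      simp only [Nat.add_sub_cancel, Fin.castSucc_mk, Fin.eta] at this
      rw [this]
      have : (i : ℕ) + 1 + j = (j + i) + 1 := by omega
      simp only [this, pow_succ, mul_neg, mul_one, neg_smul]
      exact add_neg_cancel _
  · rintro ⟨j, i⟩ - -
    dsimp only
    split_ifs with h
    · simp only [ne_eq, Prod.mk.injEq, Fin.ext_iff]; omega
    · simp only [ne_eq, Prod.mk.injEq, Fin.ext_iff]; omega
  · simp
  · rintro ⟨j, i⟩ -
    dsimp only
    grind

/-- The faces with their signs. -/
noncomputable def sface {n : ℕ} (j : Fin (n + 2)) : Tens k C (n + 1) →ₗ[k] Tens k C n :=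
  (-1 : k) ^ (j : ℕ) • face k C j

/-- The sum of all signed faces but the last one. -/
noncomputable def hochb' (n : ℕ) : Tens k C (n + 1) →ₗ[k] Tens k C n :=
  ∑ j : Fin (n + 1), sface k C j.castSucc

/-- The norm operator. -/
noncomputable def cycN (n : ℕ) : Module.End k (Tens k C n) :=
  ∑ i ∈ Finset.range (n + 1), (cyc k C n) ^ i

lemma sface_zero_cyc (n : ℕ) :
    sface k C (0 : Fin (n + 2)) ∘ₗ cyc k C (n + 1) = sface k C (Fin.last (n + 1)) := by
  refine tens_ext fun x => ?_
  simp only [sface, LinearMap.comp_apply, LinearMap.smul_apply, cyc_tprod, map_smul, face_tprod]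
  have : faceFun (0 : Fin (n + 2)) (rotFun x) = faceFun (Fin.last (n + 1)) x := by
    ext i
    obtain ⟨i, hi⟩ := i
    simp only [faceFun_apply, rotFun_apply, Fin.castSucc_mk, Fin.succ_mk, Fin.last, Fin.val_zero]
    grind
  simp [this]

lemma sface_succ_cyc (n : ℕ) (j : Fin (n + 1)) :
    sface k C j.succ ∘ₗ cyc k C (n + 1) = cyc k C n ∘ₗ sface k C j.castSucc := by
  refine tens_ext fun x => ?_
  simp only [sface, LinearMap.comp_apply, LinearMap.smul_apply, cyc_tprod, map_smul, face_tprod]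
  have : faceFun j.succ (rotFun x) = rotFun (faceFun j.castSucc x) := by
    ext i
    obtain ⟨i, hi⟩ := i
    obtain ⟨j, hj⟩ := j
    simp only [faceFun_apply, rotFun_apply, Fin.castSucc_mk, Fin.succ_mk, Fin.last]
    grind
  rw [this, smul_smul, smul_smul]
  congr 1
  simp [pow_succ, mul_comm]

lemma sface_cyc_pow (n : ℕ) (j : ℕ) (hj : j < n + 2) :
    sface k C (⟨j, hj⟩ : Fin (n + 2)) ∘ₗ (cyc k C (n + 1) ^ j : Module.End k _) =
      (cyc k C n ^ j : Module.End k _) ∘ₗ sface k C (0 : Fin (n + 2)) := by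
  induction j with
  | zero => rfl
  | succ j ih =>
    have h := sface_succ_cyc k C n ⟨j, by omega⟩
    simp only [Fin.succ_mk, Fin.castSucc_mk] at h
    rw [pow_succ', pow_succ', Module.End.mul_eq_comp, Module.End.mul_eq_comp,
      ← LinearMap.comp_assoc, h, LinearMap.comp_assoc, ih (by omega), LinearMap.comp_assoc]

lemma cyc_pow (n : ℕ) : cyc k C n ^ (n + 1) = 1 := by
  have key : ∀ i (x : Fin (n + 1) → C), (cyc k C n ^ i : Module.End k _) (PiTensorProduct.tprod k x)
      = (-1 : k) ^ (n * i) •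
        PiTensorProduct.tprod k (fun m => x (((finRotate (n + 1)) ^ i).symm m)) := by
    intro i
    induction i with
    | zero => intro x; simp; rfl
    | succ i ih =>
      intro x
      rw [pow_succ, Module.End.mul_apply, cyc_tprod, map_smul, ih, smul_smul]
      congr 1
      · ring
      · rw [pow_succ]
        rfl
  refine tens_ext fun x => ?_
  rw [key]
  have h : finRotate (n + 1) ^ (n + 1) = 1 := by
    rcases n with _ | n
    · ext i; simp
    · have := (isCycle_finRotate (n := n)).orderOf
      rw [support_finRotate] at this
      have h2 := pow_orderOf_eq_one (finRotate (n + 2))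
      rwa [this, Finset.card_univ, Fintype.card_fin] at h2
  rw [h, (Nat.even_mul_succ_self n).neg_one_pow, one_smul]
  rfl

lemma cyc_mul_cycN (n : ℕ) : cyc k C n * cycN k C n = cycN k C n := by
  have h := Finset.sum_range_succ (fun i => cyc k C n ^ i) (n + 1)
  rw [Finset.sum_range_succ', cyc_pow, pow_zero, add_left_inj] at h
  rw [cycN, Finset.mul_sum, ← h]
  simp [pow_succ']

lemma cycN_mul_cyc (n : ℕ) : cycN k C n * cyc k C n = cycN k C n := by
  rw [← cyc_mul_cycN k C n]
  conv_lhs => rw [cyc_mul_cycN]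
  exact (Commute.sum_left _ _ _ fun i _ => (Commute.refl (cyc k C n)).pow_left i).eq

lemma cyc_pow_mul_cycN (n i : ℕ) : cyc k C n ^ i * cycN k C n = cycN k C n := by
  induction i with
  | zero => simp
  | succ i ih => rw [pow_succ, mul_assoc, cyc_mul_cycN, ih]

lemma cycN_mul_cyc_pow (n i : ℕ) : cycN k C n * cyc k C n ^ i = cycN k C n := by
  induction i with
  | zero => simp
  | succ i ih => rw [pow_succ', ← mul_assoc, cycN_mul_cyc, ih]

lemma hochb'_cycN (n : ℕ) :
    hochb' k C n ∘ₗ cycN k C (n + 1) = cycN k C n ∘ₗ hochb k C n := by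
  have h1 : ∀ j : Fin (n + 1), sface k C j.castSucc ∘ₗ cycN k C (n + 1) =
      (cyc k C n ^ (j : ℕ) : Module.End k _) ∘ₗ sface k C (0 : Fin (n + 2)) ∘ₗ
        cycN k C (n + 1) := by
    intro j
    rw [← LinearMap.comp_assoc, ← sface_cyc_pow k C n j (by omega), LinearMap.comp_assoc,
      ← Module.End.mul_eq_comp, cyc_pow_mul_cycN]
    rfl
  have h2 : ∀ j : Fin (n + 2), cycN k C n ∘ₗ sface k C j =
      cycN k C n ∘ₗ sface k C (0 : Fin (n + 2)) ∘ₗ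
        (cyc k C (n + 1) ^ (n + 2 - (j : ℕ)) : Module.End k _) := by
    intro j
    have h3 : sface k C j = (sface k C j ∘ₗ (cyc k C (n + 1) ^ (j : ℕ) : Module.End k _)) ∘ₗ
        (cyc k C (n + 1) ^ (n + 2 - (j : ℕ)) : Module.End k _) := by
      rw [LinearMap.comp_assoc, ← Module.End.mul_eq_comp, ← pow_add,
        show (j : ℕ) + (n + 2 - j) = n + 1 + 1 by omega, cyc_pow]
      rfl
    rw [h3, sface_cyc_pow k C n j j.2, LinearMap.comp_assoc, ← LinearMap.comp_assoc,
      ← Module.End.mul_eq_comp, cycN_mul_cyc_pow]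
  have h4 : ∑ j : Fin (n + 2), (cyc k C (n + 1) ^ (n + 2 - (j : ℕ)) : Module.End k _) =
      cycN k C (n + 1) := by
    rw [Fin.sum_univ_eq_sum_range (fun j => cyc k C (n + 1) ^ (n + 2 - j)) (n + 2),
      ← Finset.sum_range_reflect, ← cyc_mul_cycN, cycN, Finset.mul_sum]
    refine Finset.sum_congr rfl fun i hi => ?_
    rw [← pow_succ']
    congr 1
    have := Finset.mem_range.1 hi
    omega
  have h5 : ∑ j : Fin (n + 1), (cyc k C n ^ (j : ℕ) : Module.End k _) = cycN k C n :=
    Fin.sum_univ_eq_sum_range (fun j => cyc k C n ^ j) (n + 1)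
  have h6 : hochb k C n = ∑ j : Fin (n + 2), sface k C j := rfl
  have h7 : hochb' k C n ∘ₗ cycN k C (n + 1) =
      ∑ j : Fin (n + 1), sface k C j.castSucc ∘ₗ cycN k C (n + 1) := by
    ext; simp [hochb']
  have h8 : cycN k C n ∘ₗ hochb k C n = ∑ j : Fin (n + 2), cycN k C n ∘ₗ sface k C j := by
    ext; simp [h6]
  rw [h7, h8, Finset.sum_congr rfl fun j _ => h1 j, Finset.sum_congr rfl fun j _ => h2 j]
  refine LinearMap.ext fun z => ?_
  have e4 := LinearMap.congr_fun h4 z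
  have e5 := LinearMap.congr_fun h5 (sface k C (0 : Fin (n + 2)) (cycN k C (n + 1) z))
  simp only [LinearMap.sum_apply] at e4 e5
  simp only [LinearMap.sum_apply, LinearMap.comp_apply, ← map_sum]
  rw [e4, e5]

lemma face_zero_consOne (n : ℕ) : face k C (0 : Fin (n + 2)) ∘ₗ consOne k C n = LinearMap.id := by
  refine tens_ext fun x => ?_
  rw [LinearMap.comp_apply, consOne_tprod, face_tprod, LinearMap.id_apply]
  congr 1
  ext i
  rw [faceFun_apply]
  rcases Fin.eq_zero_or_eq_succ i with rfl | ⟨i, rfl⟩ <;> simp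

lemma face_succ_consOne (n : ℕ) (j : Fin (n + 1)) :
    face k C j.castSucc.succ ∘ₗ consOne k C (n + 1) = consOne k C n ∘ₗ face k C j.castSucc := by
  refine tens_ext fun x => ?_
  rw [LinearMap.comp_apply, consOne_tprod, face_tprod, LinearMap.comp_apply, face_tprod,
    consOne_tprod]
  congr 1
  ext i
  obtain ⟨j, hj⟩ := j
  rw [faceFun_apply]
  rcases Fin.eq_zero_or_eq_succ i with rfl | ⟨⟨i, hi⟩, rfl⟩
  · simp
    omega
  · have hi' : ((⟨i, hi⟩ : Fin (n + 1)).succ.castSucc) = (⟨i, by omega⟩ : Fin (n + 2)).succ := rfl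
    rw [hi', Fin.cons_succ, Fin.cons_succ, Fin.cons_succ, faceFun_apply]
    simp only [Fin.castSucc_mk, Fin.succ_mk]
    grind

lemma face_last_consOne (n : ℕ) :
    face k C (Fin.last (n + 1)) ∘ₗ consOne k C n = (-1 : k) ^ n • cyc k C n := by
  refine tens_ext fun x => ?_
  rw [LinearMap.comp_apply, consOne_tprod, face_tprod, LinearMap.smul_apply, cyc_tprod, smul_smul,
    ← mul_pow, neg_one_mul, neg_neg, one_pow, one_smul]
  congr 1
  ext i
  rw [faceFun_apply, rotFun_apply]
  rcases Fin.eq_zero_or_eq_succ i with rfl | ⟨⟨i, hi⟩, rfl⟩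
  · simp [← Fin.succ_last]
  · have hi' : ((⟨i, hi⟩ : Fin _).succ.castSucc) = (⟨i, by omega⟩ : Fin (_ + 1)).succ := rfl
    rw [hi', Fin.cons_succ, Fin.cons_succ]
    simp [hi]

/-- `b s = 1 - t` in degree zero, for `s = consOne`. -/
lemma hochb_consOne_zero : hochb k C 0 ∘ₗ consOne k C 0 = LinearMap.id - cyc k C 0 := by
  have h0 := face_zero_consOne k C 0
  have h1 := face_last_consOne k C 0
  refine LinearMap.ext fun z => ?_
  have e0 := LinearMap.congr_fun h0 z
  have e1 := LinearMap.congr_fun h1 z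
  simp only [LinearMap.comp_apply, LinearMap.smul_apply] at e0 e1
  have h2 : hochb k C 0 = (-1 : k) ^ 0 • face k C (0 : Fin 2) +
      (-1 : k) ^ 1 • face k C (Fin.last 1) := Fin.sum_univ_two _
  simp only [h2, LinearMap.comp_apply, LinearMap.add_apply, LinearMap.smul_apply,
    LinearMap.sub_apply]
  rw [e0, e1]
  simp [sub_eq_add_neg]

/-- `b s = 1 - t - s b'` in positive degrees, for `s = consOne`. -/
lemma hochb_consOne_succ (n : ℕ) :
    hochb k C (n + 1) ∘ₗ consOne k C (n + 1) =
      LinearMap.id - cyc k C (n + 1) - consOne k C n ∘ₗ hochb' k C n := by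
  refine LinearMap.ext fun z => ?_
  have e0 := LinearMap.congr_fun (face_zero_consOne k C (n + 1)) z
  have e1 := LinearMap.congr_fun (face_last_consOne k C (n + 1)) z
  have e2 := fun j => LinearMap.congr_fun (face_succ_consOne k C n j) z
  simp only [LinearMap.comp_apply, LinearMap.smul_apply] at e0 e1 e2
  simp only [hochb, LinearMap.comp_apply, LinearMap.sum_apply,
    LinearMap.smul_apply, LinearMap.sub_apply, hochb', sface, map_sum, map_smul]
  rw [Fin.sum_univ_succ, Fin.sum_univ_castSucc]
  simp only [Fin.succ_last, e0, e1, e2]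
  simp only [Fin.val_zero, pow_zero, one_smul, Fin.val_succ, Fin.val_castSucc, Fin.val_last,
    pow_succ, mul_neg, mul_one, neg_smul, Finset.sum_neg_distrib, LinearMap.id_apply,
    neg_neg, smul_neg]
  rw [smul_smul, ← mul_pow, neg_one_mul, neg_neg, one_pow, one_smul]
  abel

lemma connesB_eq (n : ℕ) : connesB k C n = consOne k C n ∘ₗ cycN k C n := rfl

lemma hochb_connesB_zero : hochb k C 0 ∘ₗ connesB k C 0 = 0 := by
  rw [connesB_eq, ← LinearMap.comp_assoc, hochb_consOne_zero]
  have h := cyc_mul_cycN k C 0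
  rw [Module.End.mul_eq_comp] at h
  rw [LinearMap.sub_comp, h]
  simp

lemma connesB_hochb_add (n : ℕ) :
    connesB k C n ∘ₗ hochb k C n + hochb k C (n + 1) ∘ₗ connesB k C (n + 1) = 0 := by
  have h := cyc_mul_cycN k C (n + 1)
  rw [Module.End.mul_eq_comp] at h
  rw [connesB_eq, connesB_eq, ← LinearMap.comp_assoc (cycN k C (n + 1)), hochb_consOne_succ,
    LinearMap.sub_comp, LinearMap.sub_comp, h, LinearMap.comp_assoc, LinearMap.comp_assoc,
    hochb'_cycN]
  simp

/-! #### Degenerate tensors -/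

/-- The span of the tensors with at least one factor equal to `1`. -/
def withOne (n : ℕ) : Submodule k (Tens k C n) :=
  Submodule.span k {z | ∃ x : Fin (n + 1) → C, (∃ i, x i = 1) ∧ z = PiTensorProduct.tprod k x}

lemma degenerate_le_withOne (n : ℕ) : degenerate k C n ≤ withOne k C n := by
  refine Submodule.span_mono ?_
  rintro _ ⟨x, ⟨i, -, hi⟩, rfl⟩
  exact ⟨x, ⟨i, hi⟩, rfl⟩

lemma cycN_mem_withOne (n : ℕ) {z : Tens k C n} (hz : z ∈ withOne k C n) :
    cycN k C n z ∈ withOne k C n := by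
  have h1 : ∀ y ∈ withOne k C n, cyc k C n y ∈ withOne k C n := by
    intro y hy
    have : withOne k C n ≤ (withOne k C n).comap (cyc k C n) := by
      refine Submodule.span_le.2 ?_
      rintro _ ⟨x, ⟨i, hi⟩, rfl⟩
      rw [SetLike.mem_coe, Submodule.mem_comap]
      rw [cyc_tprod]
      refine Submodule.smul_mem _ _ (Submodule.subset_span ⟨_, ⟨finRotate (n + 1) i, ?_⟩, rfl⟩)
      simp [rotFun, hi]
    exact this hy
  have h2 : ∀ i : ℕ, (cyc k C n ^ i : Module.End k _) z ∈ withOne k C n := by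
    intro i
    induction i with
    | zero => simpa
    | succ i ih => rw [pow_succ']; exact h1 _ ih
  rw [cycN, LinearMap.sum_apply]
  exact Submodule.sum_mem _ fun i _ => h2 i

lemma consOne_mem_degenerate (n : ℕ) {z : Tens k C n} (hz : z ∈ withOne k C n) :
    consOne k C n z ∈ degenerate k C (n + 1) := by
  have : withOne k C n ≤ (degenerate k C (n + 1)).comap (consOne k C n) := by
    refine Submodule.span_le.2 ?_
    rintro _ ⟨x, ⟨i, hi⟩, rfl⟩
    rw [SetLike.mem_coe, Submodule.mem_comap]
    rw [consOne_tprod]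
    exact Submodule.subset_span ⟨_, ⟨i.succ, Fin.succ_ne_zero i, by simpa using hi⟩, rfl⟩
  exact this hz

lemma consOne_mem_withOne (n : ℕ) (z : Tens k C n) : consOne k C n z ∈ withOne k C (n + 1) := by
  have : (⊤ : Submodule k (Tens k C n)) ≤ (withOne k C (n + 1)).comap (consOne k C n) := by
    rw [← PiTensorProduct.span_tprod_eq_top]
    refine Submodule.span_le.2 ?_
    rintro _ ⟨x, rfl⟩
    rw [SetLike.mem_coe, Submodule.mem_comap]
    rw [consOne_tprod]
    exact Submodule.subset_span ⟨_, ⟨0, by simp⟩, rfl⟩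
  exact this trivial

lemma connesB_mem_degenerate (n : ℕ) :
    degenerate k C n ≤ (degenerate k C (n + 1)).comap (connesB k C n) := fun _ hz =>
  consOne_mem_degenerate k C n (cycN_mem_withOne k C n (degenerate_le_withOne k C n hz))

lemma connesB_connesB_mem (n : ℕ) (z : Tens k C n) :
    connesB k C (n + 1) (connesB k C n z) ∈ degenerate k C (n + 2) :=
  consOne_mem_degenerate k C (n + 1)
    (cycN_mem_withOne k C (n + 1) (consOne_mem_withOne k C n (cycN k C n z)))

lemma hochb_mem_degenerate (n : ℕ) :
    degenerate k C (n + 1) ≤ (degenerate k C n).comap (hochb k C n) := by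
  refine Submodule.span_le.2 ?_
  rintro _ ⟨x, ⟨i, hi0, hi⟩, rfl⟩
  obtain ⟨p, rfl⟩ := Fin.exists_succ_eq.2 hi0
  rw [SetLike.mem_coe, Submodule.mem_comap]
  have hi' : x ⟨(p : ℕ) + 1, by omega⟩ = 1 := hi
  rw [hochb, LinearMap.sum_apply]
  have hne : p.castSucc ≠ p.succ := (Fin.castSucc_lt_succ).ne
  rw [← Finset.sum_sdiff (Finset.subset_univ {p.castSucc, p.succ}), Finset.sum_pair hne]
  refine Submodule.add_mem _ (Submodule.sum_mem _ fun j hj => ?_) ?_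
  · simp only [Finset.mem_sdiff, Finset.mem_univ, true_and, Finset.mem_insert,
      Finset.mem_singleton, not_or, Fin.ext_iff, Fin.val_castSucc, Fin.val_succ] at hj
    rw [LinearMap.smul_apply, face_tprod]
    refine Submodule.smul_mem _ _ (Submodule.subset_span ?_)
    obtain ⟨p, hp⟩ := p
    obtain ⟨j, hj'⟩ := j
    simp only at hj hi'
    by_cases h : j < p
    · refine ⟨_, ⟨⟨p, hp⟩, by simp only [ne_eq, Fin.ext_iff, Fin.val_zero]; omega, ?_⟩, rfl⟩
      simp only [faceFun_apply, Fin.castSucc_mk, Fin.succ_mk]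
      grind
    · refine ⟨_, ⟨⟨p + 1, by omega⟩, by simp only [ne_eq, Fin.ext_iff, Fin.val_zero]; omega, ?_⟩,
        rfl⟩
      simp only [faceFun_apply, Fin.castSucc_mk, Fin.succ_mk]
      grind
  · have : faceFun p.castSucc x = faceFun p.succ x := by
      ext i
      obtain ⟨p, hp⟩ := p
      obtain ⟨i, hi⟩ := i
      simp only at hi'
      simp only [faceFun_apply, Fin.castSucc_mk, Fin.succ_mk, Fin.last]
      have hi'' := mul_one (x ⟨p, by omega⟩)
      grind
    rw [LinearMap.smul_apply, LinearMap.smul_apply, face_tprod, face_tprod, this, ← add_smul]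
    simp [pow_succ]

/-! #### The normalized mixed complex and its functoriality -/

/-- The normalized mixed complex `(C ⊗ (C/k)^{⊗ *}, b, B)` of the `k`-algebra `C`.
Its degree `n` part `C ⊗ (C/k)^{⊗ n}` is realized as the quotient of `C^{⊗ (n+1)}` by the span of
the tensors `x_0 ⊗ ⋯ ⊗ x_n` such that `x_i = 1` for some `i > 0`; these tensors span the kernel of
the surjection `C^{⊗ (n+1)} → C ⊗ (C/k)^{⊗ n}`. -/
noncomputable def normalizedMixedComplex : MixedComplex.{u, max u v} k where
  X n := Tens k C n ⧸ degenerate k C n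
  b n := Submodule.mapQ _ _ (hochb k C n) (hochb_mem_degenerate k C n)
  B n := Submodule.mapQ _ _ (connesB k C n) (connesB_mem_degenerate k C n)
  b_b n x := by
    obtain ⟨x, rfl⟩ := Submodule.mkQ_surjective _ x
    have := LinearMap.congr_fun (hochb_hochb k C n) x
    simp only [LinearMap.comp_apply] at this
    simp [this]
  B_B n x := by
    obtain ⟨x, rfl⟩ := Submodule.mkQ_surjective _ x
    simpa using connesB_connesB_mem k C n x
  B_b_add_b_B n x := by
    obtain ⟨x, rfl⟩ := Submodule.mkQ_surjective _ x
    have := LinearMap.congr_fun (connesB_hochb_add k C n) x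
    simp only [LinearMap.comp_apply, LinearMap.add_apply] at this
    simp [← Submodule.Quotient.mk_add, this]
  b_B_zero x := by
    obtain ⟨x, rfl⟩ := Submodule.mkQ_surjective _ x
    have := LinearMap.congr_fun (hochb_connesB_zero k C) x
    simp only [LinearMap.comp_apply] at this
    simp [this]

variable {k C} {D : Type v} [Ring D] [Algebra k D]

/-- The map `x_0 ⊗ ⋯ ⊗ x_n ↦ φ(x_0) ⊗ ⋯ ⊗ φ(x_n)`. -/
noncomputable def tensMap (φ : C →ₐ[k] D) (n : ℕ) : Tens k C n →ₗ[k] Tens k D n :=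
  PiTensorProduct.map fun _ => φ.toLinearMap

lemma tensMap_tprod (φ : C →ₐ[k] D) (n : ℕ) (x : Fin (n + 1) → C) :
    tensMap φ n (PiTensorProduct.tprod k x) = PiTensorProduct.tprod k (fun i => φ (x i)) := by
  simp [tensMap]

lemma tensMap_degenerate (φ : C →ₐ[k] D) (n : ℕ) :
    degenerate k C n ≤ (degenerate k D n).comap (tensMap φ n) := by
  refine Submodule.span_le.2 ?_
  rintro _ ⟨x, ⟨i, hi0, hi⟩, rfl⟩
  rw [SetLike.mem_coe, Submodule.mem_comap]
  rw [tensMap_tprod]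
  exact Submodule.subset_span ⟨_, ⟨i, hi0, by rw [hi, map_one]⟩, rfl⟩

lemma tensMap_hochb (φ : C →ₐ[k] D) (n : ℕ) :
    tensMap φ n ∘ₗ hochb k C n = hochb k D n ∘ₗ tensMap φ (n + 1) := by
  refine tens_ext fun x => ?_
  simp only [hochb, LinearMap.comp_apply, LinearMap.sum_apply, LinearMap.smul_apply, map_sum,
    map_smul, face_tprod, tensMap_tprod]
  refine Finset.sum_congr rfl fun j _ => ?_
  congr 2
  ext i
  simp only [faceFun_apply]
  split_ifs <;> simp

lemma tensMap_connesB (φ : C →ₐ[k] D) (n : ℕ) :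
    tensMap φ (n + 1) ∘ₗ connesB k C n = connesB k D n ∘ₗ tensMap φ n := by
  have h1 : ∀ z, tensMap φ (n + 1) (consOne k C n z) = consOne k D n (tensMap φ n z) := by
    refine LinearMap.congr_fun (f := tensMap φ (n + 1) ∘ₗ consOne k C n)
      (g := consOne k D n ∘ₗ tensMap φ n) (tens_ext fun x => ?_)
    simp only [LinearMap.comp_apply, consOne_tprod, tensMap_tprod]
    congr 1
    ext i
    rcases Fin.eq_zero_or_eq_succ i with rfl | ⟨i, rfl⟩ <;> simp
  have h2 : ∀ z, tensMap φ n (cyc k C n z) = cyc k D n (tensMap φ n z) := by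
    refine LinearMap.congr_fun (f := tensMap φ n ∘ₗ cyc k C n)
      (g := cyc k D n ∘ₗ tensMap φ n) (tens_ext fun x => ?_)
    simp only [LinearMap.comp_apply, cyc_tprod, tensMap_tprod, map_smul]
    rfl
  have h3 : ∀ (i : ℕ) z, tensMap φ n ((cyc k C n ^ i : Module.End k _) z) =
      (cyc k D n ^ i : Module.End k _) (tensMap φ n z) := by
    intro i
    induction i with
    | zero => intro z; simp
    | succ i ih => intro z; rw [pow_succ', pow_succ', Module.End.mul_apply, h2, ih]; rfl
  refine LinearMap.ext fun z => ?_
  simp only [connesB, LinearMap.comp_apply, h1, LinearMap.sum_apply, map_sum, h3]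

/-- The morphism of normalized mixed complexes induced by a morphism of algebras. -/
noncomputable def normalizedMixedComplexMap (φ : C →ₐ[k] D) :
    MixedComplex.Hom (normalizedMixedComplex k C) (normalizedMixedComplex k D) where
  f n := Submodule.mapQ _ _ (tensMap φ n) (tensMap_degenerate φ n)
  comm_b n x := by
    obtain ⟨x, rfl⟩ := Submodule.mkQ_surjective _ x
    have := LinearMap.congr_fun (tensMap_hochb φ n) x
    simp only [LinearMap.comp_apply] at this
    exact congrArg Submodule.Quotient.mk this
  comm_B n x := by
    obtain ⟨x, rfl⟩ := Submodule.mkQ_surjective _ x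
    have := LinearMap.congr_fun (tensMap_connesB φ n) x
    simp only [LinearMap.comp_apply] at this
    exact congrArg Submodule.Quotient.mk this

variable (k C) in
/-- The periodic cyclic homology `HP_n(C)` of the `k`-algebra `C`: the degree `n` homology of the
total complex (formed with products) of the periodic double complex of the normalized mixed
complex of `C`. -/
noncomputable def HP (n : ℤ) : ModuleCat.{max u v} k :=
  (normalizedMixedComplex k C).periodicComplex.homology n

/-- The map `HP_n(C) → HP_n(D)` induced by a morphism of algebras `C → D`. -/
noncomputable def HP.map (φ : C →ₐ[k] D) (n : ℤ) : HP k C n ⟶ HP k D n :=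
  HomologicalComplex.homologyMap
    (MixedComplex.periodicMap (normalizedMixedComplexMap φ)) n

end Algebra
end CyclicHomology

/-! The kernel of the map of periodic complexes is acyclic, because on it multiplication by the
`M`-adic weight is invertible and is null-homotopic up to terms of higher weight.

Filter `C^{⊗(n+1)}` by total weight, a factor in `M ^ q` counting for `q`. After normalization the
first step is the kernel of the projection to `C ⧸ M` (`normalizedFiltration_one`), and nilpotence
makes the filtration finite in each tensor degree (`weightFiltration_eq_bot`).

If the weight came from a grading, it would be a derivation `D`, and the Cartan homotopy formula `[b
+ B, e + E] = -L_D` would show that `L_D`, which is `p` on weight `p`, acts as zero on homology. In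
general there is only a linear `D` with `D 1 = 0` and `D x ≡ q x` modulo `M ^ (q + 1)` on `M ^ q`
(`exists_weightMap`). This is enough: the defect `D(x) y + x D(y) - D(x y)` gains one unit of weight
(`leibnizDefect_mem`), and the Cartan formula holds for every linear `D` with error terms built from
that defect (`cartan_succ`, `cartan_zero`, `hochb_contraction`). Hence `h = e + E` satisfies `d h +
h d ≡ -p` on the `p`-th step modulo the next one.

A cycle `z` of weight `p ≥ 1` is therefore homologous to `z + p⁻¹ d h z`, of weight `p + 1`; this is
where characteristic zero enters. The infinitely many corrections are finite in number in each
tensor degree, so their sum exists in the product total complex (`exists_perD_eq`). The long exact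
sequence of the kernel concludes (`isIso_homologyMap_periodicMap`).

The combinatorial core of the Cartan formula is `face_triangleSum`, an identity about two operators
of periods `K + 1` and `K`. -/

namespace CyclicHomology

/-! ### Sums over integer intervals -/

section IntervalSums

open Finset

variable {G : Type*} [AddCommGroup G]

lemma sum_Ico_split (f : ℤ → G) {a b c : ℤ} (h : a ≤ b) (h' : b ≤ c) :
    ∑ x ∈ Ico a c, f x = ∑ x ∈ Ico a b, f x + ∑ x ∈ Ico b c, f x := by
  rw [← Ico_union_Ico_eq_Ico h h', sum_union (Ico_disjoint_Ico_consecutive a b c)]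

lemma sum_Ico_shift (f : ℤ → G) (a b c : ℤ) :
    ∑ x ∈ Ico a b, f (x + c) = ∑ x ∈ Ico (a + c) (b + c), f x :=
  sum_Ico_add' f a b c

lemma sum_Ico_self_succ (f : ℤ → G) (a : ℤ) : ∑ x ∈ Ico a (a + 1), f x = f a := by
  have : Ico a (a + 1) = {a} := by ext; simp; omega
  rw [this, sum_singleton]

lemma sum_Ico_telescope (S : ℤ → G) {a b : ℤ} (h : a ≤ b) :
    ∑ j ∈ Ico a b, (S (j + 1) - S j) = S b - S a := by
  induction b, h using Int.leInduction with
  | base => simp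
  | succ b h ih =>
    rw [sum_Ico_split _ h (by omega), sum_Ico_self_succ, ih]
    abel

lemma sum_triangle_comm (f : ℤ → ℤ → G) (K : ℤ) :
    ∑ m ∈ Ico 0 K, ∑ i ∈ Ico 0 m, f m i = ∑ i ∈ Ico 0 K, ∑ m ∈ Ico (i + 1) K, f m i := by
  refine sum_comm' fun m i => ?_
  simp only [mem_Ico]
  omega

/-- A summation identity for functions on `ℤ × ℤ` with periods `(K, 0)` and `(0, K + 1)`. -/
lemma sum_biperiodic (f : ℤ → ℤ → G) (K i : ℤ) (hi₀ : 0 ≤ i) (hi : i < K)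
    (h₁ : ∀ c r, f (c + K) r = f c r) (h₂ : ∀ c r, f c (r + (K + 1)) = f c r) :
    ∑ j ∈ Ico (i + 1) K, ∑ m ∈ Ico 0 K, f (m - i) (m - i + j) +
        ∑ m ∈ Ico (i + 1) K, f (m - i) (m - i + K) =
      ∑ j ∈ Ico (i + 1) K, ∑ m ∈ Ico 0 (K + 1), f (m - j) m := by
  -- For fixed `j`, both sides sum `f c (c + j)` over windows of the same diagonal, `[-i, K - i)` on
  -- the left and `[-j, K + 1 - j)` on the right. `S j` is the part of the right window below the
  -- left one; the part of the left window above the right one is `S (j - 1)` by biperiodicity. The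
  -- differences telescope.
  let S : ℤ → G := fun j => ∑ c ∈ Ico (-j) (-i), f c (c + j)
  have key : ∀ j ∈ Ico (i + 1) K, ∑ m ∈ Ico 0 (K + 1), f (m - j) m =
      ∑ m ∈ Ico 0 K, f (m - i) (m - i + j) + (S j - S (j - 1)) := by
    intro j hj
    rw [mem_Ico] at hj
    have e₁ : ∑ m ∈ Ico 0 (K + 1), f (m - j) m = ∑ c ∈ Ico (-j) (K + 1 - j), f c (c + j) := by
      have := sum_Ico_shift (fun c => f c (c + j)) 0 (K + 1) (-j)
      rw [zero_add, ← sub_eq_add_neg] at this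
      rw [← this]
      exact sum_congr rfl fun m _ => by congr 1; ring
    have e₂ : ∑ m ∈ Ico 0 K, f (m - i) (m - i + j) = ∑ c ∈ Ico (-i) (K - i), f c (c + j) := by
      have := sum_Ico_shift (fun c => f c (c + j)) 0 K (-i)
      rw [zero_add, ← sub_eq_add_neg] at this
      rw [← this]
      rfl
    have e₃ : S (j - 1) = ∑ c ∈ Ico (K + 1 - j) (K - i), f c (c + j) := by
      have := sum_Ico_shift (fun c => f c (c + j)) (-(j - 1)) (-i) K
      rw [show -(j - 1) + K = K + 1 - j by ring, show -i + K = K - i by ring] at this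
      rw [← this]
      refine sum_congr rfl fun c _ => ?_
      rw [h₁, ← h₂ c (c + (j - 1))]
      congr 1
      ring
    rw [e₁, e₂, e₃, sum_Ico_split _ (show -j ≤ -i by omega) (show -i ≤ K + 1 - j by omega),
      sum_Ico_split _ (show -i ≤ K + 1 - j by omega) (show K + 1 - j ≤ K - i by omega)]
    simp only [S]
    abel
  rw [sum_congr rfl key, sum_add_distrib]
  congr 1
  have tel := sum_Ico_telescope (fun j => S (j - 1)) (show i + 1 ≤ K by omega)
  simp only [add_sub_cancel_right] at tel
  rw [tel]
  have hS : S i = 0 := by simp [S]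
  rw [hS, sub_zero]
  -- The surviving boundary term `S (K - 1)` is the extra sum on the left, translated by `i + K`.
  have e₄ := sum_Ico_shift (fun m => f (m - i) (m - i + K)) (-(K - 1)) (-i) (i + K)
  rw [show -(K - 1) + (i + K) = i + 1 by ring, show -i + (i + K) = K by ring] at e₄
  rw [← e₄]
  refine sum_congr rfl fun c _ => ?_
  rw [show c + (i + K) - i = c + K by ring, h₁, show c + K + K = c + (K - 1) + (K + 1) by ring, h₂]

end IntervalSums

/-! ### Cyclic sums of operators -/

section CyclicOperators

open Finset

variable {k V W : Type*} [CommRing k] [AddCommGroup V] [Module k V] [AddCommGroup W] [Module k W]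

lemma zpow_apply_zpow (τ : V ≃ₗ[k] V) (a b : ℤ) (v : V) : (τ ^ a) ((τ ^ b) v) = (τ ^ (a + b)) v := by
  rw [zpow_add]; rfl

lemma zpow_add_period (τ : V ≃ₗ[k] V) {K : ℤ} (h : τ ^ K = 1) (a : ℤ) : τ ^ (a + K) = τ ^ a := by
  rw [zpow_add, h, mul_one]

/-- `∑_{0 ≤ i < n} τ ^ i`. -/
noncomputable def cyclicNorm (τ : V ≃ₗ[k] V) (n : ℤ) : V →ₗ[k] V :=
  ∑ i ∈ Ico 0 n, (τ ^ i).toLinearMap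

lemma cyclicNorm_apply (τ : V ≃ₗ[k] V) (n : ℤ) (v : V) :
    cyclicNorm τ n v = ∑ i ∈ Ico 0 n, (τ ^ i) v := by
  simp [cyclicNorm, LinearMap.sum_apply]

/-- `∑_{0 ≤ i < j < n} τ ^ i D τ ^ (-j)`. -/
noncomputable def triangleSum (τ : V ≃ₗ[k] V) (D : V →ₗ[k] V) (n : ℤ) : V →ₗ[k] V :=
  ∑ i ∈ Ico 0 n, ∑ j ∈ Ico (i + 1) n, (τ ^ i).toLinearMap ∘ₗ D ∘ₗ (τ ^ (-j)).toLinearMap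

lemma triangleSum_apply (τ : V ≃ₗ[k] V) (D : V →ₗ[k] V) (n : ℤ) (v : V) :
    triangleSum τ D n v = ∑ i ∈ Ico 0 n, ∑ j ∈ Ico (i + 1) n, (τ ^ i) (D ((τ ^ (-j)) v)) := by
  simp [triangleSum, LinearMap.sum_apply]

/-- For each `j` the inner sum telescopes: `(1 - τ) ∑_{i < j} τ ^ i = 1 - τ ^ j`. The terms `1` add
up to `D` applied to the norm. In the Cartan formula the terms `τ ^ j` produce the Lie derivative.
-/
lemma triangleSum_sub (τ : V ≃ₗ[k] V) (D : V →ₗ[k] V) (n : ℤ) (hτ : τ ^ n = 1) (hn : 0 < n) (v : V) :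
    triangleSum τ D n v - τ (triangleSum τ D n v) =
      D (cyclicNorm τ n v) - ∑ j ∈ Ico 0 n, (τ ^ j) (D ((τ ^ (-j)) v)) := by
  have h₁ : triangleSum τ D n v =
      ∑ j ∈ Ico 0 n, ∑ i ∈ Ico 0 j, (τ ^ i) (D ((τ ^ (-j)) v)) := by
    rw [triangleSum_apply, sum_triangle_comm (fun j i => (τ ^ i) (D ((τ ^ (-j)) v)))]
  have h₂ : ∀ w, ∀ i : ℤ, τ ((τ ^ i) w) = (τ ^ (i + 1)) w := fun w i => by
    have := zpow_apply_zpow τ 1 i w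
    rwa [zpow_one, add_comm] at this
  have h₃ : cyclicNorm τ n v = ∑ j ∈ Ico 0 n, (τ ^ (-j)) v := by
    rw [cyclicNorm_apply]
    -- Reindexing by `i ↦ -i` modulo `n`, with representatives in `[0, n)`.
    refine sum_bij' (fun i _ => if i = 0 then 0 else n - i) (fun i _ => if i = 0 then 0 else n - i)
      ?_ ?_ ?_ ?_ ?_
    · intro i hi; rw [mem_Ico] at *; split_ifs <;> omega
    · intro i hi; rw [mem_Ico] at *; split_ifs <;> omega
    · intro i hi; rw [mem_Ico] at *; split_ifs <;> omega
    · intro i hi; rw [mem_Ico] at *; split_ifs <;> omega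
    · intro i hi
      split_ifs with h
      · simp [h]
      · rw [← zpow_add_period τ hτ (-(n - i))]; congr 2; ring
  rw [h₁, h₃, map_sum, map_sum, ← sum_sub_distrib, ← sum_sub_distrib]
  refine sum_congr rfl fun j hj => ?_
  rw [mem_Ico] at hj
  have tel := sum_Ico_telescope (fun i => (τ ^ i) (D ((τ ^ (-j)) v))) hj.1
  rw [sum_sub_distrib] at tel
  rw [map_sum, sum_congr rfl fun i _ => h₂ _ i, ← neg_sub, tel, zpow_zero]
  simp

/-- The failure of `D` and `D'` to be compatible with `∂` at the first slot. -/
noncomputable def firstDefect (τ : V ≃ₗ[k] V) (d : V →ₗ[k] W) (D : V →ₗ[k] V) (D' : W →ₗ[k] W) :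
    V →ₗ[k] W :=
  d ∘ₗ D + d ∘ₗ τ.toLinearMap ∘ₗ D ∘ₗ (τ ^ (-1 : ℤ)).toLinearMap - D' ∘ₗ d

/-- Abstract form of `b' T = N e + T b + defect`. Read `τ ^ a D τ ^ (-a)` as `D` acting in slot `a`
and `σ ^ m d τ ^ (-m)` as the `m`-th face. By `hd` the first face only interacts with slots `0` and
`1`, so the `m`-th face passes every slot except `m` and `m + 1`. These two slots produce the
defect, and the summands with `i = m`, `j = K` produce the norm term. -/
lemma face_triangleSum (τ : V ≃ₗ[k] V) (σ : W ≃ₗ[k] W) (d : V →ₗ[k] W) (D : V →ₗ[k] V)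
    (D' : W →ₗ[k] W) (K : ℤ) (hτ : τ ^ (K + 1) = 1) (hσ : σ ^ K = 1)
    (hd : ∀ a, 2 ≤ a → a ≤ K → ∀ v,
      d ((τ ^ a) (D ((τ ^ (-a)) v))) = (σ ^ (a - 1)) (D' ((σ ^ (1 - a)) (d v)))) (v : V) :
    ∑ m ∈ Ico 0 K, (σ ^ m) (d ((τ ^ (-m)) (triangleSum τ D (K + 1) v))) =
      cyclicNorm σ K (d (D (τ v))) +
      triangleSum σ D' K (∑ m ∈ Ico 0 (K + 1), (σ ^ m) (d ((τ ^ (-m)) v))) +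
      ∑ m ∈ Ico 0 K, ∑ j ∈ Ico (m + 1) K, (σ ^ m) (firstDefect τ d D D' ((τ ^ (-j)) v)) := by
  let T : ℤ → ℤ → ℤ → W := fun i c r => (σ ^ i) (D' ((σ ^ c) (d ((τ ^ (-r)) v))))
  have hT₁ : ∀ i c r, T i (c + K) r = T i c r := fun i c r => by
    simp only [T]; rw [zpow_add_period σ hσ]
  have hT₂ : ∀ i c r, T i c (r + (K + 1)) = T i c r := fun i c r => by
    simp only [T]; rw [← zpow_add_period τ hτ (-(r + (K + 1))), neg_add, neg_add_cancel_right]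
  -- The summand is rewritten as seen from the `m`-th face: `D` sits in slot `i - m`.
  let P : ℤ → ℤ → ℤ → W := fun m i j =>
    (σ ^ m) (d ((τ ^ (i - m)) (D ((τ ^ (-(i - m))) ((τ ^ (i - m - j)) v)))))
  have hP : ∀ m i j, (σ ^ m) (d ((τ ^ (-m)) ((τ ^ i) (D ((τ ^ (-j)) v))))) = P m i j := by
    intro m i j
    simp only [P, zpow_apply_zpow]
    rw [neg_add_eq_sub, show -(i - m) + (i - m - j) = -j by ring]
  -- For `i < m` the relative slot `i - m` is negative and wraps around to `i - m + K + 1`, which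
  -- lies in the range `[2, K]` where `hd` applies.
  have hP_lt : ∀ m i j, i < m → m < K → 0 ≤ i → P m i j = T i (m - i) (m - i + j) := by
    intro m i j h₁ h₂ h₃
    simp only [P]
    have e₁ : τ ^ (i - m) = τ ^ (i - m + (K + 1)) := (zpow_add_period τ hτ _).symm
    have e₂ : τ ^ (-(i - m)) = τ ^ (-(i - m + (K + 1))) := by
      rw [← zpow_add_period τ hτ (-(i - m + (K + 1)))]; congr 1; ring
    rw [e₁, e₂, hd _ (by omega) (by omega)]
    simp only [T, zpow_apply_zpow]
    rw [show m + (i - m + (K + 1) - 1) = i + K by ring, zpow_add_period σ hσ,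
      ← zpow_add_period σ hσ (1 - (i - m + (K + 1))),
      show 1 - (i - m + (K + 1)) + K = m - i by ring, show -(m - i + j) = i - m - j by ring]
  have hP_gt : ∀ m i j, m + 2 ≤ i → 0 ≤ m → i ≤ K →
      P m i j = T (i - 1) (m - (i - 1)) (m - (i - 1) + (j - 1)) := by
    intro m i j h₁ h₂ h₃
    simp only [P]
    rw [hd _ (by omega) (by omega)]
    simp only [T, zpow_apply_zpow]
    rw [show m + (i - m - 1) = i - 1 by ring, show 1 - (i - m) = m - (i - 1) by ring,
      show -(m - (i - 1) + (j - 1)) = i - m - j by ring]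
  have lhs : ∀ m ∈ Ico 0 K, (σ ^ m) (d ((τ ^ (-m)) (triangleSum τ D (K + 1) v))) =
      (σ ^ m) (d (D (τ v))) + ∑ j ∈ Ico (m + 1) K, (σ ^ m) (firstDefect τ d D D' ((τ ^ (-j)) v)) +
      (∑ i ∈ Ico 0 K, ∑ j ∈ Ico (i + 1) K, T i (m - i) (m - i + j) +
        ∑ i ∈ Ico 0 m, T i (m - i) (m - i + K)) := by
    intro m hm
    rw [mem_Ico] at hm
    have s₁ : (σ ^ m) (d ((τ ^ (-m)) (triangleSum τ D (K + 1) v))) =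
        ∑ i ∈ Ico 0 (K + 1), ∑ j ∈ Ico (i + 1) (K + 1), P m i j := by
      simp only [triangleSum_apply, map_sum, hP]
    rw [s₁, sum_Ico_split _ (show 0 ≤ m by omega) (show m ≤ K + 1 by omega),
      sum_Ico_split _ (show m ≤ m + 1 by omega) (show m + 1 ≤ K + 1 by omega),
      sum_Ico_split _ (show m + 1 ≤ m + 1 + 1 by omega) (show m + 1 + 1 ≤ K + 1 by omega),
      sum_Ico_self_succ, sum_Ico_self_succ]
    have s₂ : ∑ i ∈ Ico 0 m, ∑ j ∈ Ico (i + 1) (K + 1), P m i j =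
        ∑ i ∈ Ico 0 m, ∑ j ∈ Ico (i + 1) K, T i (m - i) (m - i + j) +
          ∑ i ∈ Ico 0 m, T i (m - i) (m - i + K) := by
      rw [← sum_add_distrib]
      refine sum_congr rfl fun i hi => ?_
      rw [mem_Ico] at hi
      rw [sum_congr rfl fun j _ => hP_lt m i j hi.2 hm.2 hi.1,
        sum_Ico_split _ (show i + 1 ≤ K by omega) (show K ≤ K + 1 by omega), sum_Ico_self_succ]
    have s₃ : ∑ i ∈ Ico (m + 1 + 1) (K + 1), ∑ j ∈ Ico (i + 1) (K + 1), P m i j =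
        ∑ i ∈ Ico (m + 1) K, ∑ j ∈ Ico (i + 1) K, T i (m - i) (m - i + j) := by
      rw [← sum_Ico_shift]
      refine sum_congr rfl fun i hi => ?_
      rw [mem_Ico] at hi
      rw [← sum_Ico_shift]
      refine sum_congr rfl fun j hj => ?_
      rw [hP_gt m _ _ (by omega) hm.1 (by omega), add_sub_cancel_right, add_sub_cancel_right]
    have s₄ : ∑ j ∈ Ico (m + 1) (K + 1), P m m j = (σ ^ m) (d (D (τ v))) +
        ∑ j ∈ Ico (m + 1) K, (σ ^ m) (d (D ((τ ^ (-j)) v))) := by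
      rw [sum_Ico_split _ (show m + 1 ≤ K by omega) (show K ≤ K + 1 by omega), sum_Ico_self_succ,
        add_comm]
      congr 1
      · simp only [P, sub_self, neg_zero, zpow_zero, zero_sub]
        rw [← zpow_add_period τ hτ (-K), neg_add_cancel_left, zpow_one]
        rfl
      · refine sum_congr rfl fun j _ => ?_
        simp only [P, sub_self, neg_zero, zpow_zero, zero_sub]
        rfl
    have s₅ : ∑ j ∈ Ico (m + 1 + 1) (K + 1), P m (m + 1) j =
        ∑ j ∈ Ico (m + 1) K, (σ ^ m) (d (τ (D ((τ ^ (-1 : ℤ)) ((τ ^ (-j)) v))))) := by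
      rw [← sum_Ico_shift]
      refine sum_congr rfl fun j _ => ?_
      simp only [P, add_sub_cancel_left, zpow_one]
      rw [show 1 - (j + 1) = -j by ring]
    -- The row `i = m` of `T` has no counterpart among the summands; it is supplied by the term `-D'
    -- d` of the first defect.
    have s₆ : ∑ j ∈ Ico (m + 1) K, (σ ^ m) (firstDefect τ d D D' ((τ ^ (-j)) v)) =
        ∑ j ∈ Ico (m + 1) K, (σ ^ m) (d (D ((τ ^ (-j)) v))) +
        ∑ j ∈ Ico (m + 1) K, (σ ^ m) (d (τ (D ((τ ^ (-1 : ℤ)) ((τ ^ (-j)) v))))) -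
        ∑ j ∈ Ico (m + 1) K, T m (m - m) (m - m + j) := by
      rw [← sum_add_distrib, ← sum_sub_distrib]
      refine sum_congr rfl fun j _ => ?_
      simp only [firstDefect, T, sub_self, zero_add, zpow_zero, LinearMap.sub_apply,
        LinearMap.add_apply, LinearMap.comp_apply, map_sub, map_add]
      rfl
    have s₇ := sum_Ico_split (fun i => ∑ j ∈ Ico (i + 1) K, T i (m - i) (m - i + j))
      (show 0 ≤ m by omega) (show m ≤ K by omega)
    have s₈ := sum_Ico_split (fun i => ∑ j ∈ Ico (i + 1) K, T i (m - i) (m - i + j))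
      (show m ≤ m + 1 by omega) (show m + 1 ≤ K by omega)
    rw [sum_Ico_self_succ] at s₈
    rw [s₂, s₃, s₄, s₅, s₆, s₇, s₈]
    abel
  have rhs : triangleSum σ D' K (∑ m ∈ Ico 0 (K + 1), (σ ^ m) (d ((τ ^ (-m)) v))) =
      ∑ i ∈ Ico 0 K, ∑ j ∈ Ico (i + 1) K, ∑ m ∈ Ico 0 (K + 1), T i (m - j) m := by
    rw [triangleSum_apply]
    simp only [map_sum, T, zpow_apply_zpow]
    refine sum_congr rfl fun i _ => sum_congr rfl fun j _ => sum_congr rfl fun m _ => ?_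
    rw [neg_add_eq_sub]
  -- For each fixed `i` this is `sum_biperiodic` for `T i`; the excess terms with `j = K` account
  -- for the difference between the `K` faces of `b'` and the `K + 1` faces of `b`.
  have rearrange : ∑ m ∈ Ico 0 K, ∑ i ∈ Ico 0 K, ∑ j ∈ Ico (i + 1) K, T i (m - i) (m - i + j) +
      ∑ m ∈ Ico 0 K, ∑ i ∈ Ico 0 m, T i (m - i) (m - i + K) =
      ∑ i ∈ Ico 0 K, ∑ j ∈ Ico (i + 1) K, ∑ m ∈ Ico 0 (K + 1), T i (m - j) m := by
    rw [sum_triangle_comm (fun m i => T i (m - i) (m - i + K)),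
      sum_comm (s := Ico 0 K) (t := Ico 0 K), ← sum_add_distrib]
    refine sum_congr rfl fun i hi => ?_
    rw [sum_comm, sum_biperiodic (T i) K i (mem_Ico.1 hi).1 (mem_Ico.1 hi).2 (hT₁ i) (hT₂ i)]
  rw [sum_congr rfl lhs, sum_add_distrib, sum_add_distrib, sum_add_distrib, rhs,
    ← cyclicNorm_apply, rearrange]
  abel

end CyclicOperators

end CyclicHomology

/-! ### The Cartan homotopy of a linear endomorphism on tensor powers. -/

namespace CyclicHomology

universe u v

section Slots

open PiTensorProduct Finset

variable {k : Type u} [CommRing k] {C : Type v} [Ring C] [Algebra k C]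

/-! ### Operators acting on a single tensor factor -/

/-- Apply `D` to the `j`-th entry of a tuple. -/
def slotFun (D : C → C) (j : ℕ) {n : ℕ} (x : Fin (n + 1) → C) : Fin (n + 1) → C :=
  fun i => if (i : ℕ) = j then D (x i) else x i

/-- Apply `D` to the `j`-th tensor factor. -/
noncomputable def slot (D : C →ₗ[k] C) (n j : ℕ) : Tens k C n →ₗ[k] Tens k C n :=
  PiTensorProduct.map fun i => if (i : ℕ) = j then D else LinearMap.id

lemma slot_tprod (D : C →ₗ[k] C) (n j : ℕ) (x : Fin (n + 1) → C) :
    slot D n j (tprod k x) = tprod k (slotFun D j x) := by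
  rw [slot, PiTensorProduct.map_tprod]
  congr 1
  ext i
  simp only [slotFun]
  split_ifs <;> rfl

lemma cyc_slot (D : C →ₗ[k] C) {n j : ℕ} (hj : j < n) (v : Tens k C n) :
    cyc k C n (slot D n j v) = slot D n (j + 1) (cyc k C n v) := by
  refine LinearMap.congr_fun (f := cyc k C n ∘ₗ slot D n j) (g := slot D n (j + 1) ∘ₗ cyc k C n)
    (tens_ext fun x => ?_) v
  simp only [LinearMap.comp_apply, slot_tprod, cyc_tprod, map_smul]
  congr 2
  ext ⟨i, hi⟩
  simp only [rotFun_apply, slotFun, Fin.val_last]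
  grind

lemma cyc_slot_last (D : C →ₗ[k] C) (n : ℕ) (v : Tens k C n) :
    cyc k C n (slot D n n v) = slot D n 0 (cyc k C n v) := by
  refine LinearMap.congr_fun (f := cyc k C n ∘ₗ slot D n n) (g := slot D n 0 ∘ₗ cyc k C n)
    (tens_ext fun x => ?_) v
  simp only [LinearMap.comp_apply, slot_tprod, cyc_tprod, map_smul]
  congr 2
  ext ⟨i, hi⟩
  simp only [rotFun_apply, slotFun, Fin.val_last]
  grind

lemma slot_consOne (D : C →ₗ[k] C) (n j : ℕ) (v : Tens k C n) :
    slot D (n + 1) (j + 1) (consOne k C n v) = consOne k C n (slot D n j v) := by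
  refine LinearMap.congr_fun (f := slot D (n + 1) (j + 1) ∘ₗ consOne k C n)
    (g := consOne k C n ∘ₗ slot D n j) (tens_ext fun x => ?_) v
  simp only [LinearMap.comp_apply, slot_tprod, consOne_tprod]
  congr 1
  ext i
  rcases Fin.eq_zero_or_eq_succ i with rfl | ⟨i, rfl⟩ <;> simp [slotFun]

lemma sface_slot (D : C →ₗ[k] C) {n : ℕ} (j : Fin (n + 2)) (a b : ℕ)
    (h : ∀ x : Fin (n + 2) → C, faceFun j (slotFun D a x) = slotFun D b (faceFun j x))
    (v : Tens k C (n + 1)) :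
    sface k C j (slot D (n + 1) a v) = slot D n b (sface k C j v) := by
  refine LinearMap.congr_fun (f := sface k C j ∘ₗ slot D (n + 1) a)
    (g := slot D n b ∘ₗ sface k C j) (tens_ext fun x => ?_) v
  simp only [LinearMap.comp_apply, slot_tprod, sface, LinearMap.smul_apply, face_tprod, map_smul, h]

lemma sface_zero_slot (D : C →ₗ[k] C) {n a : ℕ} (ha : 2 ≤ a) (v : Tens k C (n + 1)) :
    sface k C (0 : Fin (n + 2)) (slot D (n + 1) a v) =
      slot D n (a - 1) (sface k C (0 : Fin (n + 2)) v) := by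
  refine sface_slot D 0 a (a - 1) (fun x => ?_) v
  ext ⟨i, hi⟩
  simp only [faceFun_apply, slotFun, Fin.val_zero, Fin.castSucc_mk, Fin.succ_mk]
  grind

lemma sface_slot_last (D : C →ₗ[k] C) {n : ℕ} (j : Fin n) (v : Tens k C (n + 1)) :
    sface k C j.castSucc.castSucc (slot D (n + 1) (n + 1) v) =
      slot D n n (sface k C j.castSucc.castSucc v) := by
  refine sface_slot D _ (n + 1) n (fun x => ?_) v
  ext ⟨i, hi⟩
  obtain ⟨j, hj⟩ := j
  simp only [faceFun_apply, slotFun, Fin.castSucc_mk, Fin.succ_mk, Fin.last]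
  grind

lemma sface_last_slot (D : C →ₗ[k] C) {n : ℕ} (v : Tens k C (n + 2)) :
    sface k C (Fin.last (n + 2)) (slot D (n + 2) (n + 1) v) =
      slot D (n + 1) (n + 1) (sface k C (Fin.last (n + 2)) v) := by
  refine sface_slot D _ (n + 1) (n + 1) (fun x => ?_) v
  ext ⟨i, hi⟩
  simp only [faceFun_apply, slotFun, Fin.castSucc_mk, Fin.succ_mk, Fin.last]
  grind

lemma sface_sface_last {n : ℕ} (i : Fin (n + 2)) (v : Tens k C (n + 2)) :
    sface k C i (sface k C (Fin.last (n + 2)) v) =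
      -sface k C (Fin.last (n + 1)) (sface k C i.castSucc v) := by
  refine LinearMap.congr_fun (f := sface k C i ∘ₗ sface k C (Fin.last (n + 2)))
    (g := -(sface k C (Fin.last (n + 1)) ∘ₗ sface k C i.castSucc)) (tens_ext fun x => ?_) v
  simp only [LinearMap.comp_apply, LinearMap.neg_apply, sface, LinearMap.smul_apply, face_tprod,
    map_smul, smul_smul]
  rw [faceFun_faceFun i (Fin.last (n + 2)) i.2, ← neg_smul]
  congr 1
  simp only [Fin.val_last, Fin.val_castSucc, pow_succ]
  ring

/-! ### The cyclic permutation as an automorphism -/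

variable (k C) in
/-- The signed cyclic permutation as a linear automorphism. -/
noncomputable def cycEquiv (n : ℕ) : Tens k C n ≃ₗ[k] Tens k C n :=
  LinearEquiv.ofLinearMap (cyc k C n) (cyc k C n ^ n)
    (by rw [← Module.End.mul_eq_comp, ← pow_succ', cyc_pow]; rfl)
    (by rw [← Module.End.mul_eq_comp, ← pow_succ, cyc_pow]; rfl)

lemma cycEquiv_zpow_natCast (n i : ℕ) (v : Tens k C n) :
    (cycEquiv k C n ^ (i : ℤ)) v = (cyc k C n ^ i : Module.End k _) v := by
  rw [zpow_natCast]
  induction i with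
  | zero => rfl
  | succ i ih => rw [pow_succ', pow_succ', Module.End.mul_apply, ← ih]; rfl

lemma cycEquiv_period (n : ℕ) : cycEquiv k C n ^ ((n : ℤ) + 1) = 1 := by
  refine LinearEquiv.ext fun v => ?_
  have := cycEquiv_zpow_natCast (k := k) (C := C) n (n + 1) v
  rw [cyc_pow] at this
  exact_mod_cast this

/-- A submodule stable under the cyclic permutation is stable under all its integer powers. -/
lemma cycEquiv_zpow_mem {n : ℕ} {S : Submodule k (Tens k C n)} (hS : ∀ v ∈ S, cyc k C n v ∈ S)
    (a : ℤ) {v : Tens k C n} (hv : v ∈ S) : (cycEquiv k C n ^ a) v ∈ S := by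
  -- Exponents are reduced modulo the period to natural numbers, where induction applies; no
  -- stability under the inverse has to be assumed.
  have h : cycEquiv k C n ^ a = cycEquiv k C n ^ ((a % ((n : ℤ) + 1)).toNat : ℤ) := by
    rw [Int.toNat_of_nonneg (Int.emod_nonneg _ (by omega))]
    conv_lhs => rw [← Int.emod_add_mul_ediv a ((n : ℤ) + 1)]
    rw [zpow_add, zpow_mul, cycEquiv_period, one_zpow, mul_one]
  rw [h, cycEquiv_zpow_natCast]
  generalize (a % ((n : ℤ) + 1)).toNat = i
  induction i with
  | zero => simpa
  | succ i ih => rw [pow_succ']; exact hS _ ih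

lemma cycN_apply (n : ℕ) (v : Tens k C n) :
    cycN k C n v = cyclicNorm (cycEquiv k C n) (n + 1) v := by
  rw [cyclicNorm_apply, cycN, LinearMap.sum_apply]
  refine sum_nbij (fun i => (i : ℤ)) ?_ ?_ ?_ ?_
  · intro i hi
    rw [mem_Ico]
    have := mem_range.1 hi
    omega
  · exact Nat.cast_injective.injOn
  · intro i hi
    rw [coe_Ico, Set.mem_Ico] at hi
    exact ⟨i.toNat, by simp; omega, by simp; omega⟩
  · intro i _
    rw [cycEquiv_zpow_natCast]

/-- Together with `sface_eq`, this expresses all slots and faces as conjugates of slot `0` and face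
`0`, which is the form required by `face_triangleSum`. -/
lemma cycEquiv_zpow_slot (D : C →ₗ[k] C) {n a : ℕ} (ha : a ≤ n) (v : Tens k C n) :
    (cycEquiv k C n ^ (a : ℤ)) (slot D n 0 ((cycEquiv k C n ^ (-a : ℤ)) v)) = slot D n a v := by
  suffices h : ∀ w, (cycEquiv k C n ^ (a : ℤ)) (slot D n 0 w) =
      slot D n a ((cycEquiv k C n ^ (a : ℤ)) w) by
    rw [h, zpow_apply_zpow, add_neg_cancel, zpow_zero]
    rfl
  intro w
  simp only [cycEquiv_zpow_natCast]
  induction a with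
  | zero => rfl
  | succ a ih =>
    rw [pow_succ', Module.End.mul_apply, Module.End.mul_apply, ih (by omega),
      cyc_slot D (by omega)]

lemma sface_eq (n j : ℕ) (hj : j < n + 2) (v : Tens k C (n + 1)) :
    sface k C (⟨j, hj⟩ : Fin (n + 2)) v = (cycEquiv k C n ^ (j : ℤ))
      (sface k C (0 : Fin (n + 2)) ((cycEquiv k C (n + 1) ^ (-j : ℤ)) v)) := by
  have h := LinearMap.congr_fun (sface_cyc_pow k C n j hj) ((cycEquiv k C (n + 1) ^ (-j : ℤ)) v)
  rw [LinearMap.comp_apply, LinearMap.comp_apply, ← cycEquiv_zpow_natCast,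
    ← cycEquiv_zpow_natCast, zpow_apply_zpow, add_neg_cancel, zpow_zero] at h
  exact h

lemma sum_Ico_int_eq_sum_fin {G : Type*} [AddCommMonoid G] (n : ℕ) (f : ℤ → G) :
    ∑ m ∈ Ico 0 (n : ℤ), f m = ∑ j : Fin n, f (j : ℕ) := by
  symm
  rw [Fin.sum_univ_eq_sum_range (fun i => f (i : ℕ)) n]
  refine sum_nbij (fun i => (i : ℤ)) ?_ ?_ ?_ (fun _ _ => rfl)
  · intro i hi
    rw [mem_Ico]
    have := mem_range.1 hi
    omega
  · exact Nat.cast_injective.injOn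
  · intro i hi
    rw [coe_Ico, Set.mem_Ico] at hi
    exact ⟨i.toNat, by simp; omega, by simp; omega⟩

lemma hochb_apply (n : ℕ) (v : Tens k C (n + 1)) :
    hochb k C n v = ∑ m ∈ Ico 0 ((n : ℤ) + 1 + 1), (cycEquiv k C n ^ m)
      (sface k C (0 : Fin (n + 2)) ((cycEquiv k C (n + 1) ^ (-m)) v)) := by
  have := sum_Ico_int_eq_sum_fin (n + 2) fun m => (cycEquiv k C n ^ m)
      (sface k C (0 : Fin (n + 2)) ((cycEquiv k C (n + 1) ^ (-m)) v))
  rw [show ((n + 2 : ℕ) : ℤ) = (n : ℤ) + 1 + 1 by push_cast; ring] at this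
  rw [this, hochb, LinearMap.sum_apply]
  exact sum_congr rfl fun j _ => sface_eq n j j.2 v

lemma hochb'_apply (n : ℕ) (v : Tens k C (n + 1)) :
    hochb' k C n v = ∑ m ∈ Ico 0 ((n : ℤ) + 1), (cycEquiv k C n ^ m)
      (sface k C (0 : Fin (n + 2)) ((cycEquiv k C (n + 1) ^ (-m)) v)) := by
  have := sum_Ico_int_eq_sum_fin (n + 1) fun m => (cycEquiv k C n ^ m)
      (sface k C (0 : Fin (n + 2)) ((cycEquiv k C (n + 1) ^ (-m)) v))
  rw [show ((n + 1 : ℕ) : ℤ) = (n : ℤ) + 1 by push_cast; ring] at this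
  rw [this, hochb', LinearMap.sum_apply]
  exact sum_congr rfl fun j _ => sface_eq n j (by omega) v

/-! ### The homotopy operators -/

/-- Contraction with `D`:
`x_0 ⊗ ⋯ ⊗ x_{n+1} ↦ (-1)^{n+1} D(x_{n+1}) x_0 ⊗ x_1 ⊗ ⋯ ⊗ x_n`. -/
noncomputable def contraction (D : C →ₗ[k] C) (n : ℕ) : Tens k C (n + 1) →ₗ[k] Tens k C n :=
  sface k C (0 : Fin (n + 2)) ∘ₗ slot D (n + 1) 0 ∘ₗ cyc k C (n + 1)

/-- The sum of `t ^ i D_0 t ^ (-j)` over `0 ≤ i < j ≤ n`. -/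
noncomputable def slotTriangle (D : C →ₗ[k] C) (n : ℕ) : Tens k C n →ₗ[k] Tens k C n :=
  triangleSum (cycEquiv k C n) (slot D n 0) (n + 1)

/-- The degree-raising part of the Cartan homotopy of `D`. -/
noncomputable def suspension (D : C →ₗ[k] C) (n : ℕ) : Tens k C n →ₗ[k] Tens k C (n + 1) :=
  consOne k C n ∘ₗ slotTriangle D n

/-- The Lie derivative `∑_j D_j`. -/
noncomputable def lieDeriv (D : C →ₗ[k] C) (n : ℕ) : Tens k C n →ₗ[k] Tens k C n :=
  ∑ j : Fin (n + 1), slot D n j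

/-- The failure of `D` to be a derivation, in the first two factors:
`D(x_0) x_1 + x_0 D(x_1) - D(x_0 x_1)`. -/
noncomputable def leibnizDefect (D : C →ₗ[k] C) (n : ℕ) : Tens k C (n + 1) →ₗ[k] Tens k C n :=
  sface k C (0 : Fin (n + 2)) ∘ₗ slot D (n + 1) 0 + sface k C (0 : Fin (n + 2)) ∘ₗ slot D (n + 1) 1
    - slot D n 0 ∘ₗ sface k C (0 : Fin (n + 2))

/-- The total failure of the Cartan homotopy formula caused by the Leibniz defect. -/
noncomputable def cartanDefect (D : C →ₗ[k] C) (n : ℕ) : Tens k C (n + 1) →ₗ[k] Tens k C n :=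
  ∑ m ∈ Ico 0 ((n : ℤ) + 1), ∑ j ∈ Ico (m + 1) ((n : ℤ) + 1),
    (cycEquiv k C n ^ m).toLinearMap ∘ₗ leibnizDefect D n ∘ₗ
      (cycEquiv k C (n + 1) ^ (-j)).toLinearMap

lemma firstDefect_eq (D : C →ₗ[k] C) (n : ℕ) :
    firstDefect (cycEquiv k C (n + 1)) (sface k C (0 : Fin (n + 2))) (slot D (n + 1) 0)
      (slot D n 0) = leibnizDefect D n := by
  refine LinearMap.ext fun v => ?_
  have := cycEquiv_zpow_slot D (show 1 ≤ n + 1 by omega) v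
  simp only [Nat.cast_one, zpow_one] at this
  simp [firstDefect, leibnizDefect, ← this]

lemma contraction_eq (D : C →ₗ[k] C) (n : ℕ) (v : Tens k C (n + 1)) :
    contraction D n v = sface k C (Fin.last (n + 1)) (slot D (n + 1) (n + 1) v) := by
  rw [← sface_zero_cyc, LinearMap.comp_apply, cyc_slot_last]
  rfl

lemma lieDeriv_apply (D : C →ₗ[k] C) (n : ℕ) (v : Tens k C n) :
    lieDeriv D n v = ∑ j ∈ Ico 0 ((n : ℤ) + 1),
      (cycEquiv k C n ^ j) (slot D n 0 ((cycEquiv k C n ^ (-j)) v)) := by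
  have := sum_Ico_int_eq_sum_fin (n + 1) fun j =>
    (cycEquiv k C n ^ j) (slot D n 0 ((cycEquiv k C n ^ (-j)) v))
  rw [show ((n + 1 : ℕ) : ℤ) = (n : ℤ) + 1 by push_cast; ring] at this
  rw [this, lieDeriv, LinearMap.sum_apply]
  exact sum_congr rfl fun j _ => (cycEquiv_zpow_slot D (by omega) v).symm

/-- Case `K = n + 1` of `face_triangleSum`, for the cyclic operators on `n + 2` and `n + 1` factors.
The hypothesis on slots `a ≥ 2` holds because face `0` multiplies only the first two factors. -/
lemma hochb'_slotTriangle (D : C →ₗ[k] C) (n : ℕ) (v : Tens k C (n + 1)) :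
    hochb' k C n (slotTriangle D (n + 1) v) =
      cycN k C n (contraction D n v) + slotTriangle D n (hochb k C n v) + cartanDefect D n v := by
  have h := face_triangleSum (cycEquiv k C (n + 1)) (cycEquiv k C n) (sface k C (0 : Fin (n + 2)))
    (slot D (n + 1) 0) (slot D n 0) ((n : ℤ) + 1) ?_ (cycEquiv_period n) ?_ v
  · rw [hochb'_apply, cycN_apply, hochb_apply]
    refine Eq.trans ?_ (h.trans ?_)
    · simp [slotTriangle]
    · rw [firstDefect_eq]
      congr 1
      simp [cartanDefect, LinearMap.sum_apply]
  · exact_mod_cast cycEquiv_period (k := k) (C := C) (n + 1)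
  · intro a h2 ha w
    obtain ⟨a, rfl⟩ := Int.eq_ofNat_of_zero_le (show 0 ≤ a by omega)
    have e₁ := cycEquiv_zpow_slot D (show a ≤ n + 1 by omega) w
    have e₂ := cycEquiv_zpow_slot D (show a - 1 ≤ n by omega) (sface k C (0 : Fin (n + 2)) w)
    rw [Nat.cast_sub (by omega), Nat.cast_one, neg_sub] at e₂
    rw [e₁, sface_zero_slot D (by omega), ← e₂]

lemma slotTriangle_sub_cyc (D : C →ₗ[k] C) (n : ℕ) (v : Tens k C n) :
    slotTriangle D n v - cyc k C n (slotTriangle D n v) =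
      slot D n 0 (cycN k C n v) - lieDeriv D n v := by
  rw [cycN_apply, lieDeriv_apply, slotTriangle,
    ← triangleSum_sub _ _ _ (cycEquiv_period n) (by omega)]
  rfl

lemma contraction_consOne (D : C →ₗ[k] C) (n : ℕ) (v : Tens k C n) :
    contraction D n (consOne k C n v) = -slot D n 0 (cyc k C n v) := by
  rw [contraction_eq, slot_consOne, sface, LinearMap.smul_apply, ← LinearMap.comp_apply (face _ _ _),
    face_last_consOne, LinearMap.smul_apply, cyc_slot_last, smul_smul, Fin.val_last, pow_succ,
    mul_comm, ← mul_assoc, ← mul_pow]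
  simp

lemma contraction_connesB (D : C →ₗ[k] C) (n : ℕ) (v : Tens k C n) :
    contraction D n (connesB k C n v) = -slot D n 0 (cycN k C n v) := by
  rw [connesB_eq, LinearMap.comp_apply, contraction_consOne]
  have := LinearMap.congr_fun (cyc_mul_cycN k C n) v
  rw [Module.End.mul_apply] at this
  rw [this]

/-- The Cartan homotopy formula in positive degrees. -/
lemma cartan_succ (D : C →ₗ[k] C) (n : ℕ) (v : Tens k C (n + 1)) :
    hochb k C (n + 1) (suspension D (n + 1) v) + suspension D n (hochb k C n v) +
      connesB k C n (contraction D n v) + contraction D (n + 1) (connesB k C (n + 1) v) =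
      -lieDeriv D (n + 1) v - consOne k C n (cartanDefect D n v) := by
  have h₁ := LinearMap.congr_fun (hochb_consOne_succ k C n) (slotTriangle D (n + 1) v)
  simp only [LinearMap.comp_apply, LinearMap.sub_apply, LinearMap.id_apply] at h₁
  -- With `s = consOne`, `T = slotTriangle`, `δ = cartanDefect`: `b s T = (1 - t) T - s b' T = D_0 N
  -- - L - s (N e + T b + δ)`. Here `s N e = B e` and `s T b = E b` cancel the second and third
  -- terms, and `e B = -D_0 N` cancels the rest, leaving `-L - s δ`.
  rw [suspension, suspension, LinearMap.comp_apply, LinearMap.comp_apply, h₁, slotTriangle_sub_cyc,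
    hochb'_slotTriangle, contraction_connesB, connesB_eq, LinearMap.comp_apply, map_add, map_add]
  abel

/-- The Cartan homotopy formula in degree zero. -/
lemma cartan_zero (D : C →ₗ[k] C) (v : Tens k C 0) :
    hochb k C 0 (suspension D 0 v) + contraction D 0 (connesB k C 0 v) = -lieDeriv D 0 v := by
  have h₁ := LinearMap.congr_fun (hochb_consOne_zero k C) (slotTriangle D 0 v)
  simp only [LinearMap.comp_apply, LinearMap.sub_apply, LinearMap.id_apply] at h₁
  rw [suspension, LinearMap.comp_apply, h₁, slotTriangle_sub_cyc, contraction_connesB]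
  abel

/-- Contraction is `D` in the last slot followed by the last face. The faces not involving the last
factor commute with `D` there and cancel by `d_i d_last = -d_last d_i`. The three remaining terms
form the Leibniz defect of the last two factors, written as a rotated defect of the first two. -/
lemma hochb_contraction (D : C →ₗ[k] C) (n : ℕ) (v : Tens k C (n + 2)) :
    hochb k C n (contraction D (n + 1) v) + contraction D n (hochb k C (n + 1) v) =
      -sface k C (Fin.last (n + 1)) ((cycEquiv k C (n + 1) ^ ((n + 1 : ℕ) : ℤ))
        (leibnizDefect D (n + 1) ((cycEquiv k C (n + 2) ^ (-((n + 1 : ℕ) : ℤ))) v))) := by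
  have h₁ : hochb k C n (contraction D (n + 1) v) = -∑ i : Fin (n + 2),
      sface k C (Fin.last (n + 1)) (sface k C i.castSucc (slot D (n + 2) (n + 2) v)) := by
    rw [contraction_eq, hochb, LinearMap.sum_apply, ← sum_neg_distrib]
    exact sum_congr rfl fun i _ => sface_sface_last i _
  have h₂ : contraction D n (hochb k C (n + 1) v) = ∑ i : Fin (n + 3),
      sface k C (Fin.last (n + 1)) (slot D (n + 1) (n + 1) (sface k C i v)) := by
    rw [contraction_eq, hochb, LinearMap.sum_apply, map_sum, map_sum]
    rfl
  have h₃ : sface k C (Fin.last (n + 1)) (slot D (n + 1) (n + 1) (sface k C (Fin.last (n + 2)) v)) =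
      -sface k C (Fin.last (n + 1)) (sface k C (Fin.last (n + 1)).castSucc
        (slot D (n + 2) (n + 1) v)) := by
    rw [← sface_last_slot, sface_sface_last]
  have h₄ : (cycEquiv k C (n + 1) ^ ((n + 1 : ℕ) : ℤ))
        (leibnizDefect D (n + 1) ((cycEquiv k C (n + 2) ^ (-((n + 1 : ℕ) : ℤ))) v)) =
      sface k C (Fin.last (n + 1)).castSucc (slot D (n + 2) (n + 1) v) +
      sface k C (Fin.last (n + 1)).castSucc (slot D (n + 2) (n + 2) v) -
      slot D (n + 1) (n + 1) (sface k C (Fin.last (n + 1)).castSucc v) := by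
    have e₀ : (Fin.last (n + 1)).castSucc = (⟨n + 1, by omega⟩ : Fin (n + 3)) := rfl
    simp only [e₀, sface_eq (n + 1) (n + 1) (by omega), leibnizDefect, LinearMap.sub_apply,
      LinearMap.add_apply, LinearMap.comp_apply, map_sub, map_add]
    rw [← cycEquiv_zpow_slot D (show n + 1 ≤ n + 2 by omega),
      ← cycEquiv_zpow_slot D (show n + 2 ≤ n + 2 by omega),
      ← cycEquiv_zpow_slot D (show n + 1 ≤ n + 1 by omega),
      ← cycEquiv_zpow_slot D (show 1 ≤ n + 2 by omega)]
    simp only [zpow_apply_zpow, neg_add_cancel, zpow_zero]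
    simp only [Nat.cast_add, Nat.cast_one, Nat.cast_ofNat, zpow_one]
    rw [show -((n : ℤ) + 1) + ((n : ℤ) + 2) = 1 by ring,
      show (-1 : ℤ) + -((n : ℤ) + 1) = -((n : ℤ) + 2) by ring, zpow_one]
    rfl
  rw [h₁, h₂, h₄, Fin.sum_univ_castSucc, Fin.sum_univ_castSucc (n := n + 2),
    Fin.sum_univ_castSucc (n := n + 1), h₃,
    sum_congr rfl fun i _ => by rw [sface_slot_last D i v]]
  simp only [map_sub, map_add]
  abel

/-! ### Compatibility with degenerate tensors -/

lemma tprod_eq_zero_of_apply_eq_zero {n : ℕ} (x : Fin (n + 1) → C) (i : Fin (n + 1))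
    (h : x i = 0) : tprod k x = 0 :=
  MultilinearMap.map_coord_zero _ i h

/-- The condition `D 1 = 0` is what lets the homotopies descend to normalized chains: `D` hitting
the factor `1` kills the tensor, and otherwise that factor survives. -/
lemma slot_mem_withOne {D : C →ₗ[k] C} (hD : D 1 = 0) {n : ℕ} (j : ℕ) {v : Tens k C n}
    (hv : v ∈ withOne k C n) : slot D n j v ∈ withOne k C n := by
  suffices h : withOne k C n ≤ (withOne k C n).comap (slot D n j) from h hv
  refine Submodule.span_le.2 ?_
  rintro _ ⟨x, ⟨i, hi⟩, rfl⟩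
  rw [SetLike.mem_coe, Submodule.mem_comap, slot_tprod]
  by_cases hij : (i : ℕ) = j
  · rw [tprod_eq_zero_of_apply_eq_zero _ i (by simp [slotFun, hij, hi, hD])]
    exact zero_mem _
  · exact Submodule.subset_span ⟨_, ⟨i, by simp [slotFun, hij, hi]⟩, rfl⟩

lemma cyc_mem_withOne {n : ℕ} {v : Tens k C n} (hv : v ∈ withOne k C n) :
    cyc k C n v ∈ withOne k C n := by
  suffices h : withOne k C n ≤ (withOne k C n).comap (cyc k C n) from h hv
  refine Submodule.span_le.2 ?_
  rintro _ ⟨x, ⟨i, hi⟩, rfl⟩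
  rw [SetLike.mem_coe, Submodule.mem_comap, cyc_tprod]
  refine Submodule.smul_mem _ _ (Submodule.subset_span ⟨_, ⟨finRotate (n + 1) i, ?_⟩, rfl⟩)
  simp [rotFun, hi]

lemma slotTriangle_mem_withOne {D : C →ₗ[k] C} (hD : D 1 = 0) {n : ℕ} {v : Tens k C n}
    (hv : v ∈ withOne k C n) : slotTriangle D n v ∈ withOne k C n := by
  rw [slotTriangle, triangleSum_apply]
  exact sum_mem fun i _ => sum_mem fun j _ => cycEquiv_zpow_mem (fun _ => cyc_mem_withOne) _
    (slot_mem_withOne hD _ (cycEquiv_zpow_mem (fun _ => cyc_mem_withOne) _ hv))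

lemma suspension_mem_degenerate {D : C →ₗ[k] C} (hD : D 1 = 0) (n : ℕ) :
    degenerate k C n ≤ (degenerate k C (n + 1)).comap (suspension D n) := fun _ hv =>
  consOne_mem_degenerate k C n (slotTriangle_mem_withOne hD (degenerate_le_withOne k C n hv))

/-- Only the last factor is moved. If it is the factor `1`, then `D` kills it; otherwise the factor
`1` keeps its positive index. -/
lemma contraction_mem_degenerate {D : C →ₗ[k] C} (hD : D 1 = 0) (n : ℕ) :
    degenerate k C (n + 1) ≤ (degenerate k C n).comap (contraction D n) := by
  refine Submodule.span_le.2 ?_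
  rintro _ ⟨x, ⟨i, hi0, hi⟩, rfl⟩
  rw [SetLike.mem_coe, Submodule.mem_comap, contraction_eq, slot_tprod, sface,
    LinearMap.smul_apply]
  by_cases hin : (i : ℕ) = n + 1
  · rw [tprod_eq_zero_of_apply_eq_zero _ i (by simp [slotFun, hin, hi, hD]), map_zero, smul_zero]
    exact zero_mem _
  · rw [face_tprod]
    have hi0' : (i : ℕ) ≠ 0 := fun h => hi0 (Fin.ext h)
    refine Submodule.smul_mem _ _ (Submodule.subset_span
      ⟨_, ⟨⟨i, by omega⟩, fun h => hi0' (congrArg Fin.val h), ?_⟩, rfl⟩)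
    have : (i : ℕ) < n + 1 := by omega
    simp [faceFun_apply, slotFun, hin, hi0', this, hi]

/-- Two successive applications of `consOne`, with a rotation-invariant operator between them, leave
a `1` in positive position. -/
lemma connesB_suspension_mem (D : C →ₗ[k] C) (n : ℕ) (v : Tens k C n) :
    connesB k C (n + 1) (suspension D n v) ∈ degenerate k C (n + 2) :=
  consOne_mem_degenerate k C (n + 1)
    (cycN_mem_withOne k C (n + 1) (consOne_mem_withOne k C n _))

lemma suspension_connesB_mem {D : C →ₗ[k] C} (hD : D 1 = 0) (n : ℕ) (v : Tens k C n) :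
    suspension D (n + 1) (connesB k C n v) ∈ degenerate k C (n + 2) :=
  consOne_mem_degenerate k C (n + 1)
    (slotTriangle_mem_withOne hD (consOne_mem_withOne k C n _))

end Slots

end CyclicHomology

/-! ### The weight filtration, and the Cartan formula modulo higher weight. -/

namespace CyclicHomology

universe u v

section Filtration

open PiTensorProduct Finset

variable (k : Type u) [CommRing k] {C : Type v} [Ring C] [Algebra k C] (M : Ideal C)

lemma mul_mem_pow_add [M.IsTwoSided] {a b : ℕ} {x y : C} (hx : x ∈ M ^ a) (hy : y ∈ M ^ b) :
    x * y ∈ M ^ (a + b) := by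
  rw [Ideal.IsTwoSided.pow_add]
  exact Ideal.mul_mem_mul hx hy

lemma mem_pow_zero (x : C) : x ∈ M ^ 0 := by
  rw [Submodule.pow_zero, Ideal.one_eq_top]
  trivial

/-! ### The filtration of tensor powers by weight -/

/-- The span of the tensors `x_0 ⊗ ⋯ ⊗ x_n` with `x_i ∈ M ^ (w i)` and `∑ w i ≥ p`. -/
def weightFiltration (n p : ℕ) : Submodule k (Tens k C n) :=
  Submodule.span k {z | ∃ (x : Fin (n + 1) → C) (w : Fin (n + 1) → ℕ),
    (∀ i, x i ∈ M ^ w i) ∧ p ≤ ∑ i, w i ∧ z = tprod k x}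

variable {k M}

lemma tprod_mem_weightFiltration {n p : ℕ} {x : Fin (n + 1) → C} (w : Fin (n + 1) → ℕ)
    (hx : ∀ i, x i ∈ M ^ w i) (hp : p ≤ ∑ i, w i) : tprod k x ∈ weightFiltration k M n p :=
  Submodule.subset_span ⟨x, w, hx, hp, rfl⟩

lemma weightFiltration_anti {n p q : ℕ} (h : p ≤ q) :
    weightFiltration k M n q ≤ weightFiltration k M n p := by
  refine Submodule.span_mono ?_
  rintro _ ⟨x, w, hx, hq, rfl⟩
  exact ⟨x, w, hx, h.trans hq, rfl⟩

lemma map_mem_weightFiltration {n m c : ℕ} {f : Tens k C n →ₗ[k] Tens k C m}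
    (h : ∀ (x : Fin (n + 1) → C) (w : Fin (n + 1) → ℕ), (∀ i, x i ∈ M ^ w i) →
      f (tprod k x) ∈ weightFiltration k M m (∑ i, w i + c))
    {p : ℕ} {v : Tens k C n} (hv : v ∈ weightFiltration k M n p) :
    f v ∈ weightFiltration k M m (p + c) := by
  suffices H : weightFiltration k M n p ≤ (weightFiltration k M m (p + c)).comap f from H hv
  refine Submodule.span_le.2 ?_
  rintro _ ⟨x, w, hx, hp, rfl⟩
  exact weightFiltration_anti (by omega) (h x w hx)

/-- Pigeonhole: a total weight of at least `r * (n + 1)` over `n + 1` factors forces one factor into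
`M ^ r = 0`. The bound grows with `n`, so the filtration is finite only degreewise. -/
lemma weightFiltration_eq_bot {r : ℕ} (hM : M ^ r = ⊥) {n p : ℕ} (h : r * (n + 1) ≤ p) :
    weightFiltration k M n p = ⊥ := by
  rw [eq_bot_iff]
  refine Submodule.span_le.2 ?_
  rintro _ ⟨x, w, hx, hp, rfl⟩
  obtain ⟨i, hi⟩ : ∃ i, r ≤ w i := by
    by_contra! hlt
    have : ∑ i, w i < ∑ _i : Fin (n + 1), r :=
      sum_lt_sum_of_nonempty univ_nonempty fun i _ => hlt i
    simp only [sum_const, card_univ, Fintype.card_fin, smul_eq_mul] at this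
    linarith
  have h0 : x i = 0 := by
    have := Ideal.pow_le_pow_right hi (hx i)
    rwa [hM, Submodule.mem_bot] at this
  rw [tprod_eq_zero_of_apply_eq_zero x i h0]
  exact zero_mem _

lemma cyc_mem_weightFiltration {n p : ℕ} {v : Tens k C n} (hv : v ∈ weightFiltration k M n p) :
    cyc k C n v ∈ weightFiltration k M n p := by
  refine map_mem_weightFiltration (c := 0) (fun x w hx => ?_) hv
  rw [cyc_tprod]
  exact Submodule.smul_mem _ _ (tprod_mem_weightFiltration
    (fun i => w ((finRotate (n + 1)).symm i)) (fun i => hx _) (Equiv.sum_comp _ w).ge)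

lemma cycEquiv_zpow_mem_weightFiltration {n p : ℕ} (a : ℤ) {v : Tens k C n}
    (hv : v ∈ weightFiltration k M n p) :
    (cycEquiv k C n ^ a) v ∈ weightFiltration k M n p :=
  cycEquiv_zpow_mem (fun _ => cyc_mem_weightFiltration) a hv

lemma consOne_mem_weightFiltration {n p : ℕ} {v : Tens k C n}
    (hv : v ∈ weightFiltration k M n p) :
    consOne k C n v ∈ weightFiltration k M (n + 1) p := by
  refine map_mem_weightFiltration (c := 0) (fun x w hx => ?_) hv
  rw [consOne_tprod]
  refine tprod_mem_weightFiltration (Fin.cons 0 w) (fun i => ?_) ?_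
  · rcases Fin.eq_zero_or_eq_succ i with rfl | ⟨i, rfl⟩
    · exact mem_pow_zero M _
    · simpa using hx i
  · rw [Fin.sum_univ_succ (n := n + 1)]
    simp

/-- The weights of the `0`-th face of a tensor. -/
lemma sum_firstFace_weight {n : ℕ} (w : Fin (n + 2) → ℕ) :
    ∑ i : Fin (n + 1), (if (i : ℕ) = 0 then w i.castSucc + w i.succ else w i.succ) = ∑ i, w i := by
  rw [Fin.sum_univ_succ (n := n), Fin.sum_univ_succ (n := n + 1), Fin.sum_univ_succ (n := n)]
  simp [add_assoc]

lemma sface_zero_mem_weightFiltration [M.IsTwoSided] {n p : ℕ} {v : Tens k C (n + 1)}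
    (hv : v ∈ weightFiltration k M (n + 1) p) :
    sface k C (0 : Fin (n + 2)) v ∈ weightFiltration k M n p := by
  refine map_mem_weightFiltration (c := 0) (fun x w hx => ?_) hv
  rw [sface, LinearMap.smul_apply, face_tprod]
  refine Submodule.smul_mem _ _ (tprod_mem_weightFiltration _ (fun i => ?_)
    (sum_firstFace_weight w).ge)
  rcases Fin.eq_zero_or_eq_succ i with rfl | ⟨i, rfl⟩
  · simpa [faceFun_apply] using mul_mem_pow_add M (hx 0) (hx 1)
  · simpa [faceFun_apply] using hx i.succ.succ

variable {D : C →ₗ[k] C}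

lemma apply_mem_of_weight (hD : ∀ q x, x ∈ M ^ q → D x - q • x ∈ M ^ (q + 1)) {q : ℕ} {x : C}
    (hx : x ∈ M ^ q) : D x ∈ M ^ q := by
  have h₁ := Ideal.pow_le_pow_right (Nat.le_succ q) (hD q x hx)
  have h₂ := add_mem h₁ (nsmul_mem hx q)
  rwa [sub_add_cancel] at h₂

lemma slot_mem_weightFiltration (hD : ∀ q x, x ∈ M ^ q → D x - q • x ∈ M ^ (q + 1)) {n p : ℕ}
    (j : ℕ) {v : Tens k C n} (hv : v ∈ weightFiltration k M n p) :
    slot D n j v ∈ weightFiltration k M n p := by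
  refine map_mem_weightFiltration (c := 0) (fun x w hx => ?_) hv
  rw [slot_tprod]
  refine tprod_mem_weightFiltration w (fun i => ?_) le_rfl
  rw [slotFun]
  split_ifs
  · exact apply_mem_of_weight hD (hx i)
  · exact hx i

/-- On a tensor of weights `w`, the operator `D` in slot `j` is multiplication by `w j` up to a gain
of one weight unit, so `L_D` is multiplication by `∑ j, w j` up to such a gain. -/
lemma lieDeriv_sub_mem (hD : ∀ q x, x ∈ M ^ q → D x - q • x ∈ M ^ (q + 1)) {n p : ℕ}
    {v : Tens k C n} (hv : v ∈ weightFiltration k M n p) :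
    lieDeriv D n v - p • v ∈ weightFiltration k M n (p + 1) := by
  suffices H : weightFiltration k M n p ≤
      (weightFiltration k M n (p + 1)).comap (lieDeriv D n - p • LinearMap.id) from H hv
  refine Submodule.span_le.2 ?_
  rintro _ ⟨x, w, hx, hp, rfl⟩
  rw [SetLike.mem_coe, Submodule.mem_comap]
  have h₁ : ∀ j : Fin (n + 1), slot D n j (tprod k x) - w j • tprod k x ∈
      weightFiltration k M n (p + 1) := by
    intro j
    have e₁ : slotFun D j x = Function.update x j (D (x j)) := by
      ext i
      by_cases hij : i = j
      · subst hij; simp [slotFun]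
      · simp [slotFun, hij, Fin.val_inj]
    have e₂ : w j • tprod k x = tprod k (Function.update x j ((w j : k) • x j)) := by
      rw [MultilinearMap.map_update_smul, Function.update_eq_self, Nat.cast_smul_eq_nsmul]
    rw [slot_tprod, e₁, e₂, ← MultilinearMap.map_update_sub, Nat.cast_smul_eq_nsmul]
    refine tprod_mem_weightFiltration (Function.update w j (w j + 1)) (fun i => ?_) ?_
    · by_cases hij : i = j
      · subst hij; simpa using hD _ _ (hx i)
      · simpa [hij] using hx i
    · rw [sum_update_of_mem (mem_univ j), add_assoc, add_comm 1, ← add_assoc, sdiff_singleton_eq_erase,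
        add_sum_erase _ _ (mem_univ j)]
      omega
  -- Weights are only bounded below by `p`. The excess `∑ j, w j - p` either vanishes or multiplies
  -- a tensor already in the next step.
  have h₂ : (lieDeriv D n - p • LinearMap.id : Tens k C n →ₗ[k] Tens k C n) (tprod k x) =
      ∑ j : Fin (n + 1), (slot D n j (tprod k x) - w j • tprod k x) +
        (∑ j, w j - p) • tprod k x := by
    rw [sum_sub_distrib, ← sum_smul, LinearMap.sub_apply, lieDeriv, LinearMap.sum_apply,
      show (p • LinearMap.id : Tens k C n →ₗ[k] _) (tprod k x) = p • tprod k x from rfl]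
    conv_lhs => rw [show p = ∑ j, w j - (∑ j, w j - p) by omega]
    rw [sub_nsmul _ (Nat.sub_le _ _)]
    abel
  rw [h₂]
  refine add_mem (sum_mem fun j _ => h₁ j) ?_
  rcases hp.eq_or_lt with h | h
  · rw [h, Nat.sub_self, zero_smul]
    exact zero_mem _
  · exact nsmul_mem (tprod_mem_weightFiltration w hx h) _

/-- For `x ∈ M ^ a` and `y ∈ M ^ b` the leading terms of `D(x) y + x D(y) - D(x y)` are `a + b - (a
+ b)` times `x y`, hence cancel: `D` is a derivation on the associated graded. -/
lemma leibnizDefect_mem [M.IsTwoSided] (hD : ∀ q x, x ∈ M ^ q → D x - q • x ∈ M ^ (q + 1))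
    {n p : ℕ} {v : Tens k C (n + 1)} (hv : v ∈ weightFiltration k M (n + 1) p) :
    leibnizDefect D n v ∈ weightFiltration k M n (p + 1) := by
  refine map_mem_weightFiltration (fun x w hx => ?_) hv
  have e : ∀ a, ∀ y : Fin (n + 1) → C, y 0 = a → (∀ i : Fin n, y i.succ = x i.succ.succ) →
      tprod k y = tprod k (Function.update (faceFun 0 x) 0 a) := by
    rintro a y rfl hy
    congr 1
    ext i
    rcases Fin.eq_zero_or_eq_succ i with rfl | ⟨i, rfl⟩
    · simp
    · simp [hy, faceFun_apply]
  have e₁ : faceFun 0 (slotFun D 0 x) 0 = D (x 0) * x 1 := by simp [faceFun_apply, slotFun]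
  have e₂ : faceFun 0 (slotFun D 1 x) 0 = x 0 * D (x 1) := by simp [faceFun_apply, slotFun]
  have e₃ : slotFun D 0 (faceFun 0 x) 0 = D (x 0 * x 1) := by simp [faceFun_apply, slotFun]
  simp only [leibnizDefect, LinearMap.sub_apply, LinearMap.add_apply, LinearMap.comp_apply,
    slot_tprod, sface, face_tprod, Fin.val_zero, pow_zero, one_smul]
  rw [e _ _ e₁ fun i => by simp [faceFun_apply, slotFun],
    e _ _ e₂ fun i => by simp [faceFun_apply, slotFun],
    e _ _ e₃ fun i => by simp [faceFun_apply, slotFun], ← MultilinearMap.map_update_add,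
    ← MultilinearMap.map_update_sub]
  refine tprod_mem_weightFiltration (fun i : Fin (n + 1) =>
    (if (i : ℕ) = 0 then w i.castSucc + w i.succ else w i.succ) + if i = 0 then 1 else 0)
    (fun i => ?_) ?_
  · rcases Fin.eq_zero_or_eq_succ i with rfl | ⟨i, rfl⟩
    · have h₁ := mul_mem_pow_add M (hD _ _ (hx 0)) (hx 1)
      have h₂ := mul_mem_pow_add M (hx 0) (hD _ _ (hx 1))
      have h₃ := hD _ _ (mul_mem_pow_add M (hx 0) (hx 1))
      rw [show w 0 + 1 + w 1 = w 0 + w 1 + 1 by ring] at h₁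
      rw [← add_assoc] at h₂
      have := sub_mem (add_mem h₁ h₂) h₃
      simp only [Function.update_self, Fin.val_zero, if_true, Fin.castSucc_zero, Fin.succ_zero_eq_one]
      convert this using 1
      simp only [sub_mul, mul_sub, add_smul, smul_mul_assoc, mul_smul_comm]
      abel
    · simpa [faceFun_apply] using hx i.succ.succ
  · rw [sum_add_distrib, sum_firstFace_weight]
    simp

lemma contraction_mem_weightFiltration [M.IsTwoSided]
    (hD : ∀ q x, x ∈ M ^ q → D x - q • x ∈ M ^ (q + 1)) {n p : ℕ}
    {v : Tens k C (n + 1)} (hv : v ∈ weightFiltration k M (n + 1) p) :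
    contraction D n v ∈ weightFiltration k M n p :=
  sface_zero_mem_weightFiltration (slot_mem_weightFiltration hD 0 (cyc_mem_weightFiltration hv))

lemma suspension_mem_weightFiltration (hD : ∀ q x, x ∈ M ^ q → D x - q • x ∈ M ^ (q + 1))
    {n p : ℕ} {v : Tens k C n} (hv : v ∈ weightFiltration k M n p) :
    suspension D n v ∈ weightFiltration k M (n + 1) p := by
  refine consOne_mem_weightFiltration ?_
  rw [slotTriangle, triangleSum_apply]
  exact sum_mem fun i _ => sum_mem fun j _ => cycEquiv_zpow_mem_weightFiltration _
    (slot_mem_weightFiltration hD _ (cycEquiv_zpow_mem_weightFiltration _ hv))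

lemma cartanDefect_mem [M.IsTwoSided] (hD : ∀ q x, x ∈ M ^ q → D x - q • x ∈ M ^ (q + 1))
    {n p : ℕ} {v : Tens k C (n + 1)} (hv : v ∈ weightFiltration k M (n + 1) p) :
    cartanDefect D n v ∈ weightFiltration k M n (p + 1) := by
  simp only [cartanDefect, LinearMap.sum_apply, LinearMap.comp_apply]
  exact sum_mem fun i _ => sum_mem fun j _ => cycEquiv_zpow_mem_weightFiltration _
    (leibnizDefect_mem hD (cycEquiv_zpow_mem_weightFiltration _ hv))

lemma hochb_contraction_mem [M.IsTwoSided] (hD : ∀ q x, x ∈ M ^ q → D x - q • x ∈ M ^ (q + 1))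
    {n p : ℕ} {v : Tens k C (n + 2)} (hv : v ∈ weightFiltration k M (n + 2) p) :
    hochb k C n (contraction D (n + 1) v) + contraction D n (hochb k C (n + 1) v) ∈
      weightFiltration k M n (p + 1) := by
  rw [hochb_contraction]
  refine neg_mem ?_
  rw [← sface_zero_cyc]
  exact sface_zero_mem_weightFiltration (cyc_mem_weightFiltration
    (cycEquiv_zpow_mem_weightFiltration _
      (leibnizDefect_mem hD (cycEquiv_zpow_mem_weightFiltration _ hv))))

lemma cartan_succ_mem [M.IsTwoSided] (hD : ∀ q x, x ∈ M ^ q → D x - q • x ∈ M ^ (q + 1))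
    {n p : ℕ} {v : Tens k C (n + 1)} (hv : v ∈ weightFiltration k M (n + 1) p) :
    hochb k C (n + 1) (suspension D (n + 1) v) + suspension D n (hochb k C n v) +
      connesB k C n (contraction D n v) + contraction D (n + 1) (connesB k C (n + 1) v) + p • v ∈
      weightFiltration k M (n + 1) (p + 1) := by
  rw [cartan_succ]
  have := neg_mem (add_mem (lieDeriv_sub_mem hD hv)
    (consOne_mem_weightFiltration (cartanDefect_mem hD hv)))
  convert this using 1
  abel

lemma cartan_zero_mem (hD : ∀ q x, x ∈ M ^ q → D x - q • x ∈ M ^ (q + 1))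
    {p : ℕ} {v : Tens k C 0} (hv : v ∈ weightFiltration k M 0 p) :
    hochb k C 0 (suspension D 0 v) + contraction D 0 (connesB k C 0 v) + p • v ∈
      weightFiltration k M 0 (p + 1) := by
  rw [cartan_zero]
  have := neg_mem (lieDeriv_sub_mem hD hv)
  convert this using 1
  abel

end Filtration

end CyclicHomology

/-! ### Acyclicity from a weight homotopy, and the resulting isomorphism on periodic homology. -/

namespace CyclicHomology

universe u v w

namespace MixedComplex

section Acyclic

variable {k : Type u} [Field k]

/-- The total differential `b + B` of the periodic complex. -/
def perD (X : MixedComplex.{u, w} k) {i j : ℤ} (h : j + 1 = i) : X.PerTot i →ₗ[k] X.PerTot j :=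
  X.perb h + X.perB h

lemma even_contract {i j : ℤ} (h : j + 1 = i) {m : ℕ} (hm : Even (i - (m : ℤ))) :
    Even (j - ((m + 1 : ℕ) : ℤ)) := by
  subst h
  obtain ⟨r, hr⟩ := hm
  exact ⟨r - 1, by push_cast; linarith⟩

lemma even_suspend {i j : ℤ} (h : j + 1 = i) {m : ℕ} (hm : Even (i - ((m + 1 : ℕ) : ℤ))) :
    Even (j - (m : ℤ)) := by
  subst h; push_cast at hm; rwa [add_sub_add_right_eq_sub] at hm

/-- The operator on periodic total complexes assembled from operators `e` of degree `-1` and `E` of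
degree `1`. -/
def perHomotopy (X : MixedComplex.{u, w} k) (e : ∀ n, X.X (n + 1) →ₗ[k] X.X n)
    (E : ∀ n, X.X n →ₗ[k] X.X (n + 1)) {i j : ℤ} (h : j + 1 = i) (x : X.PerTot j) : X.PerTot i
  | ⟨0, hm⟩ => e 0 (x ⟨1, even_contract h hm⟩)
  | ⟨m + 1, hm⟩ => e (m + 1) (x ⟨m + 2, even_contract h hm⟩) + E m (x ⟨m, even_suspend h hm⟩)

/-- Operators `e`, `E` on a filtered mixed complex which act like a contracting homotopy
`[b + B, e + E] = -p` on the `p`-th step of the filtration, modulo the next step. -/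
structure WeightHomotopy (X : MixedComplex.{u, w} k) (F : ℕ → ∀ n, Submodule k (X.X n)) where
  anti : ∀ p n, F (p + 1) n ≤ F p n
  bound : ℕ → ℕ
  eq_bot : ∀ n p, bound n ≤ p → F p n = ⊥
  e : ∀ n, X.X (n + 1) →ₗ[k] X.X n
  E : ∀ n, X.X n →ₗ[k] X.X (n + 1)
  e_mem : ∀ p n x, x ∈ F p (n + 1) → e n x ∈ F p n
  E_mem : ∀ p n x, x ∈ F p n → E n x ∈ F p (n + 1)
  b_e : ∀ p n x, x ∈ F p (n + 2) → X.b n (e (n + 1) x) + e n (X.b (n + 1) x) ∈ F (p + 1) n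
  weight_succ : ∀ p n x, x ∈ F p (n + 1) →
    X.b (n + 1) (E (n + 1) x) + E n (X.b n x) + X.B n (e n x) + e (n + 1) (X.B (n + 1) x) + p • x ∈
      F (p + 1) (n + 1)
  weight_zero : ∀ p x, x ∈ F p 0 → X.b 0 (E 0 x) + e 0 (X.B 0 x) + p • x ∈ F (p + 1) 0
  B_E : ∀ n x, X.B (n + 1) (E n x) + E (n + 1) (X.B n x) = 0

namespace WeightHomotopy

variable {X : MixedComplex.{u, w} k} {F : ℕ → ∀ n, Submodule k (X.X n)}

lemma perHomotopy_mem (H : WeightHomotopy X F) {p : ℕ} {i j : ℤ} (h : j + 1 = i) {x : X.PerTot j}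
    (hx : ∀ m, x m ∈ F p m.1) (m) : X.perHomotopy H.e H.E h x m ∈ F p m.1 := by
  obtain ⟨_ | m, hm⟩ := m
  · exact H.e_mem p 0 _ (hx ⟨1, even_contract h hm⟩)
  · exact add_mem (H.e_mem p (m + 1) _ (hx ⟨m + 2, even_contract h hm⟩))
      (H.E_mem p m _ (hx ⟨m, even_suspend h hm⟩))

/-- The component in degree `m` separates by source: `x_{m+2}` enters through `[b, e]`, `x_m`
through `[b, E] + [B, e] + p`, and `x_{m-2}` through `[B, E] = 0`. The degrees `0` and `1` are
separate because some of these terms are absent there. -/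
lemma perD_perHomotopy (H : WeightHomotopy X F) {p : ℕ} {i j l : ℤ} (h : j + 1 = i)
    (h' : l + 1 = j) {x : X.PerTot j} (hx : ∀ m, x m ∈ F p m.1) (m) :
    (X.perD h (X.perHomotopy H.e H.E h x) + X.perHomotopy H.e H.E h' (X.perD h' x) + p • x) m ∈
      F (p + 1) m.1 := by
  obtain ⟨m, hm⟩ := m
  match m, hm with
  | 0, hm =>
    have := add_mem (H.b_e p 0 _ (hx ⟨2, even_contract h (even_b h hm)⟩))
      (H.weight_zero p _ (hx ⟨0, hm⟩))
    convert this using 1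
    simp only [perD, perb, perB, perHomotopy, Pi.add_apply, LinearMap.add_apply, LinearMap.coe_mk,
      AddHom.coe_mk, map_add, add_zero, Pi.smul_apply]
    abel
  | 1, hm =>
    have := add_mem (H.b_e p 1 _ (hx ⟨3, even_contract h (even_b h hm)⟩))
      (H.weight_succ p 0 _ (hx ⟨1, hm⟩))
    convert this using 1
    simp only [perD, perb, perB, perHomotopy, Pi.add_apply, LinearMap.add_apply, LinearMap.coe_mk,
      AddHom.coe_mk, map_add, add_zero, Pi.smul_apply]
    abel
  | m + 2, hm =>
    have h₁ := add_mem (H.b_e p (m + 2) _ (hx ⟨m + 4, even_contract h (even_b h hm)⟩))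
      (H.weight_succ p (m + 1) _ (hx ⟨m + 2, hm⟩))
    have h₂ : X.B (m + 1) (H.E m (x ⟨m, even_suspend h (even_B h hm)⟩)) +
        H.E (m + 1) (X.B m (x ⟨m, even_suspend h (even_B h hm)⟩)) ∈ F (p + 1) (m + 2) := by
      rw [H.B_E]
      exact zero_mem _
    convert add_mem h₁ h₂ using 1
    simp only [perD, perb, perB, perHomotopy, Pi.add_apply, LinearMap.add_apply, LinearMap.coe_mk,
      AddHom.coe_mk, map_add, Pi.smul_apply]
    abel

/-- Successive corrections of a cycle `z` lying in the first step of the filtration. -/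
noncomputable def corrections (H : WeightHomotopy X F) {i j : ℤ} (h : j + 1 = i) (z : X.PerTot j) :
    ℕ → X.PerTot j
  | 0 => z
  | p + 1 => H.corrections h z p -
      X.perD h (-((p + 1 : ℕ) : k)⁻¹ • X.perHomotopy H.e H.E h (H.corrections h z p))

/-- The `p`-th correction lies in step `p + 1`. As it is a cycle `z`, the homotopy formula reads `d
h z + (p + 1) z ∈ F (p + 2)`, and division by `p + 1` shows that the next correction lies one step
deeper. -/
lemma corrections_spec [CharZero k] (H : WeightHomotopy X F) {i j l : ℤ} (h : j + 1 = i)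
    (h' : l + 1 = j) {z : X.PerTot j} (hz : ∀ m, z m ∈ F 1 m.1) (hdz : X.perD h' z = 0) (p : ℕ) :
    (∀ m, H.corrections h z p m ∈ F (p + 1) m.1) ∧ X.perD h' (H.corrections h z p) = 0 := by
  induction p with
  | zero => exact ⟨hz, hdz⟩
  | succ p ih =>
    refine ⟨fun m => ?_, ?_⟩
    · have h₁ := H.perD_perHomotopy h h' ih.1 m
      have h₀ : X.perHomotopy H.e H.E h' (0 : X.PerTot l) = 0 := by
        funext ⟨m, hm⟩
        cases m <;> simp [perHomotopy]
      rw [ih.2, h₀, add_zero] at h₁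
      have h₂ := (F (p + 1 + 1) m.1).smul_mem ((p + 1 : ℕ) : k)⁻¹ h₁
      convert h₂ using 1
      have hp : ((p + 1 : ℕ) : k) ≠ 0 := Nat.cast_ne_zero.2 (Nat.succ_ne_zero p)
      rw [corrections, map_smul, Pi.add_apply, smul_add, Pi.smul_apply,
        ← Nat.cast_smul_eq_nsmul k, smul_smul, inv_mul_cancel₀ hp, one_smul, Pi.sub_apply,
        Pi.smul_apply, neg_smul, sub_neg_eq_add, add_comm]
    · rw [corrections, map_sub, ih.2, zero_sub, neg_eq_zero]
      exact X.per_d_d h h' _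

/-- The partial sums of the `Y p` bound `z` up to a correction of ever higher weight. In each tensor
degree this correction eventually vanishes and the sum stabilizes, so the limit exists in the
product total complex. -/
lemma exists_perD_eq [CharZero k] (H : WeightHomotopy X F) {i j l : ℤ} (h : j + 1 = i)
    (h' : l + 1 = j) {z : X.PerTot j} (hz : ∀ m, z m ∈ F 1 m.1) (hdz : X.perD h' z = 0) :
    ∃ y : X.PerTot i, (∀ m, y m ∈ F 1 m.1) ∧ X.perD h y = z := by
  let Y : ℕ → X.PerTot i := fun p =>
    -((p + 1 : ℕ) : k)⁻¹ • X.perHomotopy H.e H.E h (H.corrections h z p)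
  have anti : ∀ p n, F (p + 1) n ≤ F 1 n := by
    intro p n
    induction p with
    | zero => exact le_rfl
    | succ p ih => exact (H.anti _ _).trans ih
  have hY : ∀ p m, Y p m ∈ F (p + 1) m.1 := fun p m =>
    Submodule.smul_mem _ _ (H.perHomotopy_mem h (H.corrections_spec h h' hz hdz p).1 m)
  have hsum : ∀ P, z = H.corrections h z P + X.perD h (∑ p ∈ Finset.range P, Y p) := by
    intro P
    induction P with
    | zero => simp [corrections]
    | succ P ih =>
      rw [Finset.sum_range_succ, map_add, corrections]
      conv_lhs => rw [ih]
      simp only [Y]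
      abel
  -- In degree `m` the terms with `p ≥ bound m` vanish, so the infinite sum is truncated there.
  let y : X.PerTot i := fun m => ∑ p ∈ Finset.range (H.bound m.1), Y p m
  have hy : ∀ P m, H.bound m.1 ≤ P → y m = (∑ p ∈ Finset.range P, Y p) m := by
    intro P m hP
    rw [Finset.sum_apply]
    refine Finset.sum_subset (Finset.range_mono hP) fun p _ hp => ?_
    have := hY p m
    rw [H.eq_bot _ _ (by rw [Finset.mem_range] at hp; omega)] at this
    exact (Submodule.mem_bot k).1 this
  refine ⟨y, fun m => sum_mem fun p _ => anti p _ (hY p m), ?_⟩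
  funext ⟨m, hm⟩
  -- Component `m` of the differential sees only the components `m + 1` and `m - 1`; one `P` beyond
  -- all three bounds replaces `y` by a finite sum and makes the remaining correction vanish. For `m
  -- = 0` the truncated `m - 1` is harmless.
  let P := H.bound m + H.bound (m + 1) + H.bound (m - 1)
  have e₁ : X.perD h y ⟨m, hm⟩ = X.perD h (∑ p ∈ Finset.range P, Y p) ⟨m, hm⟩ := by
    rcases m with _ | m
    · simp only [perD, perb, perB, LinearMap.add_apply, Pi.add_apply, LinearMap.coe_mk,
        AddHom.coe_mk]
      rw [hy P _ (by simp only [P]; omega)]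
    · simp only [perD, perb, perB, LinearMap.add_apply, Pi.add_apply, LinearMap.coe_mk,
        AddHom.coe_mk]
      rw [hy P _ (by simp only [P]; omega), hy P _ (by simp only [P, Nat.add_sub_cancel]; omega)]
  have e₂ : H.corrections h z P ⟨m, hm⟩ = 0 := by
    have := (H.corrections_spec h h' hz hdz P).1 ⟨m, hm⟩
    rw [H.eq_bot _ _ (by simp only [P]; omega)] at this
    exact (Submodule.mem_bot k).1 this
  rw [e₁]
  conv_rhs => rw [hsum P]
  rw [Pi.add_apply, e₂, zero_add]

end WeightHomotopy

/-! ### Surjections with filtered kernel -/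

section Quasi

open CategoryTheory

variable {X Y : MixedComplex.{u, w} k}

/-- The kernel of a morphism of mixed complexes. -/
def Hom.ker (φ : Hom X Y) : MixedComplex.{u, w} k where
  X n := LinearMap.ker (φ.f n)
  b n := (X.b n).restrict fun x hx => by
    rw [LinearMap.mem_ker] at *
    rw [φ.comm_b, hx, map_zero]
  B n := (X.B n).restrict fun x hx => by
    rw [LinearMap.mem_ker] at *
    rw [φ.comm_B, hx, map_zero]
  b_b n x := Subtype.ext (X.b_b n x)
  B_B n x := Subtype.ext (X.B_B n x)
  B_b_add_b_B n x := Subtype.ext (X.B_b_add_b_B n x)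
  b_B_zero x := Subtype.ext (X.b_B_zero x)

/-- The inclusion of the kernel. -/
def Hom.kerι (φ : Hom X Y) : Hom φ.ker X where
  f n := (LinearMap.ker (φ.f n)).subtype
  comm_b _ _ := rfl
  comm_B _ _ := rfl

/-- The sequence of periodic complexes attached to a morphism and its kernel. -/
noncomputable def kerShortComplex (φ : Hom X Y) : ShortComplex (ChainComplex (ModuleCat.{w} k) ℤ) where
  X₁ := φ.ker.periodicComplex
  X₂ := X.periodicComplex
  X₃ := Y.periodicComplex
  f := periodicMap φ.kerι
  g := periodicMap φ
  zero := by
    ext n x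
    exact funext fun m => (x m).2

lemma kerShortComplex_shortExact (φ : Hom X Y) (hφ : ∀ n, Function.Surjective (φ.f n)) :
    (kerShortComplex φ).ShortExact := by
  refine HomologicalComplex.shortExact_of_degreewise_shortExact _ fun n => ?_
  refine ModuleCat.shortComplex_shortExact _ ?_ ?_ ?_
  · intro x
    constructor
    · intro hx
      exact ⟨fun m => ⟨x m, congrFun hx m⟩, rfl⟩
    · rintro ⟨y, rfl⟩
      exact funext fun m => (y m).2
  · intro x y h
    exact funext fun m => Subtype.ext (congrFun h m)
  · intro y
    choose x hx using fun m : {m : ℕ // Even (n - (m : ℤ))} => hφ m.1 (y m)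
    exact ⟨x, funext hx⟩

lemma periodicComplex_d_apply (X : MixedComplex.{u, w} k) {i j : ℤ} (h : j + 1 = i)
    (x : X.PerTot i) : (X.periodicComplex.d i j).hom x = X.perD h x := by
  simp only [periodicComplex, dif_pos h]
  rfl

lemma kerι_perD (φ : Hom X Y) {i j : ℤ} (h : j + 1 = i) (x : φ.ker.PerTot i) (m) :
    φ.kerι.f m.1 (φ.ker.perD h x m) =
      X.perD h (fun m => φ.kerι.f m.1 (x m)) m := by
  obtain ⟨_ | m, hm⟩ := m <;> rfl

/-- Exactness needs a primitive inside the kernel itself; `exists_perD_eq` gives one in `F 1`, which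
is that kernel. -/
lemma ker_exactAt [CharZero k] (φ : Hom X Y) {F : ℕ → ∀ n, Submodule k (X.X n)}
    (H : WeightHomotopy X F) (hF : ∀ n, F 1 n = LinearMap.ker (φ.f n)) (n : ℤ) :
    φ.ker.periodicComplex.ExactAt n := by
  rw [HomologicalComplex.exactAt_iff' _ (n + 1) n (n - 1) (by simp) (by simp),
    ShortComplex.moduleCat_exact_iff]
  intro (z : φ.ker.PerTot n) hz
  have h' : n - 1 + 1 = n := by ring
  have hz' : φ.ker.perD h' z = 0 := by
    exact (periodicComplex_d_apply φ.ker h' z).symm.trans hz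
  obtain ⟨y, hy, hyz⟩ := H.exists_perD_eq (rfl : n + 1 = n + 1) h'
    (z := fun m => φ.kerι.f m.1 (z m))
    (fun m => by rw [hF]; exact (z m).2)
    (funext fun m => by rw [← kerι_perD, hz']; exact map_zero _)
  simp only [hF] at hy
  refine ⟨(fun m => ⟨y m, hy m⟩ : φ.ker.PerTot (n + 1)), ?_⟩
  refine (periodicComplex_d_apply φ.ker rfl _).trans (funext fun m => Subtype.ext ?_)
  exact (kerι_perD φ rfl _ m).trans (congrFun hyz m)

/-- A degreewise surjective morphism of mixed complexes whose kernel is the first step of a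
filtration admitting a weight homotopy induces isomorphisms on periodic homology. -/
theorem isIso_homologyMap_periodicMap [CharZero k] (φ : Hom X Y)
    (hφ : ∀ n, Function.Surjective (φ.f n)) {F : ℕ → ∀ n, Submodule k (X.X n)}
    (H : WeightHomotopy X F) (hF : ∀ n, F 1 n = LinearMap.ker (φ.f n)) (n : ℤ) :
    IsIso (HomologicalComplex.homologyMap (periodicMap φ) n) := by
  have hS := kerShortComplex_shortExact φ hφ
  -- In the long exact sequence, vanishing of the kernel's homology in degree `n` gives injectivity,
  -- and in degree `n - 1` surjectivity.
  have h₁ := (ker_exactAt φ H hF n).isZero_homology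
  have h₂ := (ker_exactAt φ H hF (n - 1)).isZero_homology
  have : Mono (HomologicalComplex.homologyMap (periodicMap φ) n) :=
    (hS.homology_exact₂ n).mono_g (h₁.eq_of_src _ _)
  have : Epi (HomologicalComplex.homologyMap (periodicMap φ) n) :=
    (hS.homology_exact₃ n (n - 1) (by simp)).epi_f (h₂.eq_of_tgt _ _)
  exact isIso_of_mono_of_epi _

end Quasi

end Acyclic

end MixedComplex

end CyclicHomology

/-! ### The weight map of a nilpotent ideal, and the kernel of the projection on normalized chains.
-/

namespace CyclicHomology

universe u v

section Nilpotent

open PiTensorProduct Finset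

variable {k : Type u} [Field k] {C : Type v} [Ring C] [Algebra k C]

/-! ### A linear map acting by the weight on the powers of a nilpotent ideal -/

/-- Over a field, `I` has a linear complement containing `1` as soon as `1 ∉ I`; the projection
along it kills `1`. If `1 ∈ I`, the algebra is zero and so is the map. -/
lemma exists_projection_apply_one (I : Ideal C) (hI : (1 : C) ∈ I → Subsingleton C) :
    ∃ π : C →ₗ[k] C, (∀ x, π x ∈ I) ∧ (∀ x ∈ I, π x = x) ∧ π 1 = 0 := by
  by_cases h1 : (1 : C) ∈ I
  · have := hI h1
    exact ⟨0, fun x => by simp, fun x _ => Subsingleton.elim _ _, rfl⟩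
  let S : Submodule k C := I.restrictScalars k
  have hd : Disjoint S (k ∙ (1 : C)) := by
    rw [Submodule.disjoint_span_singleton]
    intro h
    exact absurd h h1
  obtain ⟨T, hT, hc⟩ := hd.symm.exists_isCompl
  refine ⟨S.subtype ∘ₗ Submodule.projectionOnto S T hc.symm, fun x => ?_, fun x hx => ?_, ?_⟩
  · exact (Submodule.projectionOnto S T hc.symm x).2
  · exact congrArg Subtype.val (Submodule.projectionOnto_apply_left hc.symm ⟨x, hx⟩)
  · have h1T : (1 : C) ∈ T := hT (Submodule.mem_span_singleton_self 1)
    rw [LinearMap.comp_apply, (Submodule.projectionOnto_apply_eq_zero_iff hc.symm).2 h1T, map_zero]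

variable (k) in
-- `D` is the sum of projections `π p` onto `M ^ (p + 1)` for `p < r`. On `x ∈ M ^ q` the first `q`
-- of them are the identity and give `q • x`, while the others take values in `M ^ (q + 1)`.
lemma exists_weightMap {M : Ideal C} {r : ℕ} (hM : M ^ r = ⊥) :
    ∃ D : C →ₗ[k] C, D 1 = 0 ∧ ∀ q x, x ∈ M ^ q → D x - q • x ∈ M ^ (q + 1) := by
  have hI : ∀ p, 1 ≤ p → (1 : C) ∈ M ^ p → Subsingleton C := by
    intro p hp h
    have hM1 : M = ⊤ := M.eq_top_iff_one.2 (Ideal.pow_le_self (by omega) h)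
    have htop : M ^ r = ⊤ := by rw [hM1, Ideal.top_pow]
    rw [hM] at htop
    have : (1 : C) ∈ (⊥ : Ideal C) := by rw [htop]; trivial
    rw [Submodule.mem_bot] at this
    exact subsingleton_of_zero_eq_one this.symm
  choose π hπ₁ hπ₂ hπ₃ using fun p : ℕ =>
    exists_projection_apply_one (k := k) (M ^ (p + 1)) (hI (p + 1) (by omega))
  refine ⟨∑ p ∈ range r, π p, by simp [LinearMap.sum_apply, hπ₃], fun q x hx => ?_⟩
  rcases le_total r q with h | h
  · have : x = 0 := by
      have := Ideal.pow_le_pow_right h hx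
      rwa [hM, Submodule.mem_bot] at this
    rw [this, map_zero, smul_zero, sub_zero]
    exact zero_mem _
  · rw [LinearMap.sum_apply, ← sum_range_add_sum_Ico _ h]
    have h₁ : ∑ p ∈ range q, π p x = q • x := by
      rw [sum_congr rfl fun p hp => hπ₂ p x (Ideal.pow_le_pow_right (mem_range.1 hp) hx)]
      simp
    rw [h₁, add_sub_cancel_left]
    exact sum_mem fun p hp =>
      Ideal.pow_le_pow_right (by have := (mem_Ico.1 hp).1; omega) (hπ₁ p x)

/-! ### The kernel of the projection -/

variable (M : Ideal C) [M.IsTwoSided]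

/-- A linear section `s` of the projection differs from a left inverse by elements of `M`. Hence the
composite of the projection with the tensor power of `s` is the identity modulo weight one, and what
the projection kills has weight at least one. -/
lemma ker_tensMap_le (n : ℕ) :
    LinearMap.ker (tensMap (Ideal.Quotient.mkₐ k M) n) ≤ weightFiltration k M n 1 := by
  obtain ⟨s, hs⟩ := (Ideal.Quotient.mkₐ k M).toLinearMap.exists_rightInverse_of_surjective
    (LinearMap.range_eq_top.2 (Ideal.Quotient.mkₐ_surjective k M))
  have hs' : ∀ x, s (Ideal.Quotient.mkₐ k M x) - x ∈ M := by
    intro x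
    have := LinearMap.congr_fun hs (Ideal.Quotient.mkₐ k M x)
    exact Ideal.Quotient.eq.1 this
  let σ : Tens k (C ⧸ M) n →ₗ[k] Tens k C n := PiTensorProduct.map fun _ => s
  have key : ∀ v, σ (tensMap (Ideal.Quotient.mkₐ k M) n v) - v ∈ weightFiltration k M n 1 := by
    intro v
    induction v using PiTensorProduct.induction_on with
    | smul_tprod c x =>
      rw [map_smul, map_smul, ← smul_sub]
      refine Submodule.smul_mem _ _ ?_
      rw [tensMap_tprod, PiTensorProduct.map_tprod]
      -- Multilinear expansion over subsets of factors: the empty subset returns `x`, and every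
      -- other one contains a factor `s (π x_i) - x_i ∈ M`.
      have e : (fun i => s (Ideal.Quotient.mkₐ k M (x i))) =
          (fun i => s (Ideal.Quotient.mkₐ k M (x i)) - x i) + x := by
        ext i; simp
      rw [e, MultilinearMap.map_add_univ, ← add_sum_erase _ _ (mem_univ ∅), piecewise_empty,
        add_sub_cancel_left]
      refine sum_mem fun S hS => ?_
      obtain ⟨i, hi⟩ := nonempty_iff_ne_empty.2 (ne_of_mem_erase hS)
      refine tprod_mem_weightFiltration (fun j => if j = i then 1 else 0) (fun j => ?_) (by simp)
      split_ifs with hj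
      · subst hj
        rw [piecewise_eq_of_mem _ _ _ hi, Submodule.pow_one]
        exact hs' _
      · exact mem_pow_zero M _
    | add v w hv hw =>
      have := add_mem hv hw
      rwa [sub_add_sub_comm, ← map_add, ← map_add] at this
  intro v hv
  have := key v
  rw [LinearMap.mem_ker.1 hv, map_zero, zero_sub] at this
  simpa using neg_mem this

lemma weightFiltration_one_le_ker (n : ℕ) :
    weightFiltration k M n 1 ≤ LinearMap.ker (tensMap (Ideal.Quotient.mkₐ k M) n) := by
  refine Submodule.span_le.2 ?_
  rintro _ ⟨x, w, hx, hw, rfl⟩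
  obtain ⟨i, -, hi⟩ : ∃ i ∈ univ, w i ≠ 0 := exists_ne_zero_of_sum_ne_zero (by omega)
  rw [SetLike.mem_coe, LinearMap.mem_ker, tensMap_tprod]
  refine tprod_eq_zero_of_apply_eq_zero _ i ?_
  exact Ideal.Quotient.eq_zero_iff_mem.2 (Ideal.pow_le_self hi (hx i))

/-- A factor `1` can be lifted to `1`, so degenerate tensors lift to degenerate ones. A normalized
chain in the kernel can thus be represented by a tensor that the projection kills, which is the step
needed in `normalizedFiltration_one`. -/
lemma degenerate_le_map (n : ℕ) : degenerate k (C ⧸ M) n ≤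
    (degenerate k C n).map (tensMap (Ideal.Quotient.mkₐ k M) n) := by
  refine Submodule.span_le.2 ?_
  rintro _ ⟨x, ⟨i, hi0, hi⟩, rfl⟩
  choose y hy using fun j => Ideal.Quotient.mkₐ_surjective k M (x j)
  refine ⟨tprod k (Function.update y i 1),
    Submodule.subset_span ⟨_, ⟨i, hi0, Function.update_self ..⟩, rfl⟩, ?_⟩
  rw [tensMap_tprod]
  congr 1
  ext j
  by_cases hj : j = i
  · subst hj; rw [Function.update_self, map_one, hi]
  · rw [Function.update_of_ne hj, hy]

variable (k)

/-- The weight filtration of the normalized mixed complex. -/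
def normalizedFiltration (p n : ℕ) : Submodule k (Tens k C n ⧸ degenerate k C n) :=
  (weightFiltration k M n p).map (degenerate k C n).mkQ

lemma normalizedFiltration_one (n : ℕ) : normalizedFiltration k M 1 n =
    LinearMap.ker ((normalizedMixedComplexMap (Ideal.Quotient.mkₐ k M)).f n) := by
  refine le_antisymm ?_ ?_
  · rintro _ ⟨v, hv, rfl⟩
    have h := weightFiltration_one_le_ker M n hv
    exact congrArg (Submodule.Quotient.mk (p := degenerate k (C ⧸ M) n)) (LinearMap.mem_ker.1 h)
  · intro z hz
    obtain ⟨v, rfl⟩ := Submodule.mkQ_surjective _ z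
    have h : tensMap (Ideal.Quotient.mkₐ k M) n v ∈ degenerate k (C ⧸ M) n :=
      (Submodule.Quotient.mk_eq_zero _).1 hz
    obtain ⟨u, hu, huv⟩ := degenerate_le_map M n h
    refine ⟨v - u, ker_tensMap_le M n ?_, ?_⟩
    · rw [LinearMap.mem_ker, map_sub, huv, sub_self]
    · refine (Submodule.Quotient.eq _).2 ?_
      rw [sub_sub_cancel_left]
      exact neg_mem hu

lemma normalizedMixedComplexMap_surjective (n : ℕ) : Function.Surjective
    ((normalizedMixedComplexMap (Ideal.Quotient.mkₐ k M)).f n) := by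
  intro z
  obtain ⟨v, rfl⟩ := Submodule.mkQ_surjective _ z
  obtain ⟨u, rfl⟩ : ∃ u, tensMap (Ideal.Quotient.mkₐ k M) n u = v := by
    rw [← LinearMap.mem_range]
    have : LinearMap.range (tensMap (Ideal.Quotient.mkₐ k M) n) = ⊤ := by
      rw [eq_top_iff, ← PiTensorProduct.span_tprod_eq_top]
      refine Submodule.span_le.2 ?_
      rintro _ ⟨x, rfl⟩
      choose y hy using fun j => Ideal.Quotient.mkₐ_surjective k M (x j)
      exact ⟨tprod k y, by rw [tensMap_tprod]; congr 1; ext j; exact hy j⟩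
    rw [this]
    trivial
  exact ⟨Submodule.Quotient.mk u, rfl⟩

variable {k M}

/-- The Cartan homotopy of a weight map on the normalized mixed complex. -/
noncomputable def normalizedWeightHomotopy {r : ℕ} (hM : M ^ r = ⊥) {D : C →ₗ[k] C} (hD1 : D 1 = 0)
    (hD : ∀ q x, x ∈ M ^ q → D x - q • x ∈ M ^ (q + 1)) :
    MixedComplex.WeightHomotopy (normalizedMixedComplex k C) (normalizedFiltration k M) where
  anti p n := Submodule.map_mono (weightFiltration_anti (Nat.le_succ p))
  bound n := r * (n + 1)
  eq_bot n p h := (congrArg (Submodule.map (degenerate k C n).mkQ)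
    (weightFiltration_eq_bot hM h)).trans (Submodule.map_bot _)
  e n := Submodule.mapQ _ _ (contraction D n) (contraction_mem_degenerate hD1 n)
  E n := Submodule.mapQ _ _ (suspension D n) (suspension_mem_degenerate hD1 n)
  e_mem p n := by
    rintro _ ⟨v, hv, rfl⟩
    exact ⟨_, contraction_mem_weightFiltration hD hv, rfl⟩
  E_mem p n := by
    rintro _ ⟨v, hv, rfl⟩
    exact ⟨_, suspension_mem_weightFiltration hD hv, rfl⟩
  b_e p n := by
    rintro _ ⟨v, hv, rfl⟩
    exact ⟨_, hochb_contraction_mem hD hv, rfl⟩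
  weight_succ p n := by
    rintro _ ⟨v, hv, rfl⟩
    exact ⟨_, cartan_succ_mem hD hv, rfl⟩
  weight_zero p := by
    rintro _ ⟨v, hv, rfl⟩
    exact ⟨_, cartan_zero_mem hD hv, rfl⟩
  B_E n z := by
    obtain ⟨v, rfl⟩ := Submodule.mkQ_surjective _ z
    exact (Submodule.Quotient.mk_eq_zero _).2
      (add_mem (connesB_suspension_mem D n v) (suspension_connesB_mem hD1 n v))

end Nilpotent

end CyclicHomology

theorem theorem3p6 (k : Type*) [Field k] [CharZero k] (C : Type*) [Ring C] [Algebra k C]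
    (M : Ideal C) [M.IsTwoSided] (hM : IsNilpotent M) (n : ℤ) :
    CategoryTheory.IsIso (CyclicHomology.HP.map (Ideal.Quotient.mkₐ k M) n) := by
  obtain ⟨r, hr⟩ := hM
  obtain ⟨D, hD1, hD⟩ := CyclicHomology.exists_weightMap k hr
  exact CyclicHomology.MixedComplex.isIso_homologyMap_periodicMap _
    (CyclicHomology.normalizedMixedComplexMap_surjective k M)
    (CyclicHomology.normalizedWeightHomotopy hr hD1 hD)
    (CyclicHomology.normalizedFiltration_one k M) n
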